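/- Let $L>0$. There exists a function $\psi\in C^\infty([-L,L])$ with $\psi>0$ on $[-L,L]$ (depending only on $L$) such that, for every $T>0$, there exist positive constants $s_0=s_0(L,T)$ and $C=C(L,T)$ with the following property. For all $s\ge s_0$ and every real-valued $$q\in L^2(0,T;H^3(-L,L))\cap H^1(0,T;L^2(-L,L))$$ satisfying $$q(t,\pm L)=q_x(t,\pm L)=q_{xx}(t,\pm L)=0\quad\text{for almost every } t\in(0,T),$$ one has $$\int_0^T\!\!\int_{-L}^{L}\Big\{\frac{s^5}{t^5(T-t)^5}|q|^2+\frac{s^3}{t^3(T-t)^3}|q_x|^2+\frac{s}{t(T-t)}|q_{xx}|^2\Big\}e^{-\frac{2s\psi(x)}{t(T-t)}}\,dx\,dt\le C\int_0^T\!\!\int_{-L}^{L}|q_t-q_{xx}+q_{xxx}|^2e^{-\frac{2s\psi(x)}{t(T-t)}}\,dx\,dt .$$ -/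

import Mathlib

open MeasureTheory Set
open scoped ENNReal ContDiff

namespace CarlemanKdVB

/-- `φ` belongs to `C_c^∞(a, b)`. -/
def IsTestFunction (a b : ℝ) (φ : ℝ → ℝ) : Prop :=
  ContDiff ℝ ∞ φ ∧ HasCompactSupport φ ∧ tsupport φ ⊆ Ioo a b

/-- `g` is the weak (distributional) derivative of `f` on the interval `(a, b)`. The functions may
take values in a normed space `E`; the integrals are Bochner integrals. It is used only for `f` and
`g` that are square integrable on a bounded interval. -/
def HasWeakDeriv {E : Type*} [NormedAddCommGroup E] [NormedSpace ℝ E]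
    (a b : ℝ) (f g : ℝ → E) : Prop :=
  ∀ φ : ℝ → ℝ, IsTestFunction a b φ →
    ∫ x in Ioo a b, deriv φ x • f x = - ∫ x in Ioo a b, φ x • g x

/-- The real Hilbert space `L²(a, b)`. -/
abbrev L2 (a b : ℝ) : Type := Lp ℝ 2 (volume.restrict (Ioo a b))

theorem IsTestFunction.integrable_smul {a b : ℝ} {φ : ℝ → ℝ} (hφ : IsTestFunction a b φ)
    (f : L2 a b) : Integrable (fun x => φ x • f x) (volume.restrict (Ioo a b)) := by
  have h1 : Integrable f (volume.restrict (Ioo a b)) :=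
    (Lp.memLp f).integrable (by norm_num)
  obtain ⟨C, hC⟩ := hφ.1.continuous.bounded_above_of_compact_support hφ.2.1
  exact h1.bdd_mul hφ.1.continuous.aestronglyMeasurable (Filter.Eventually.of_forall hC)

theorem IsTestFunction.deriv {a b : ℝ} {φ : ℝ → ℝ} (hφ : IsTestFunction a b φ) :
    IsTestFunction a b (deriv φ) :=
  ⟨(contDiff_infty_iff_deriv.1 hφ.1).2, hφ.2.1.deriv, (tsupport_deriv_subset).trans hφ.2.2⟩

theorem HasWeakDeriv.L2_zero (a b : ℝ) : HasWeakDeriv a b (0 : L2 a b) (0 : L2 a b) := by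
  intro φ _
  have h0 := Lp.coeFn_zero ℝ 2 (volume.restrict (Ioo a b))
  rw [integral_eq_zero_of_ae, integral_eq_zero_of_ae, neg_zero]
  · filter_upwards [h0] with x hx
    rw [hx]; simp
  · filter_upwards [h0] with x hx
    rw [hx]; simp

theorem HasWeakDeriv.L2_add {a b : ℝ} {f f' g g' : L2 a b} (hf : HasWeakDeriv a b f f')
    (hg : HasWeakDeriv a b g g') : HasWeakDeriv a b (f + g : L2 a b) (f' + g' : L2 a b) := by
  intro φ hφ
  have key : ∀ (χ : ℝ → ℝ), IsTestFunction a b χ → ∀ u v : L2 a b,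
      ∫ x in Ioo a b, χ x • (u + v : L2 a b) x =
        (∫ x in Ioo a b, χ x • u x) + ∫ x in Ioo a b, χ x • v x := by
    intro χ hχ u v
    rw [← integral_add (hχ.integrable_smul u) (hχ.integrable_smul v)]
    refine integral_congr_ae ?_
    filter_upwards [Lp.coeFn_add u v] with x hx
    rw [hx, Pi.add_apply, smul_add]
  rw [key _ hφ.deriv, key _ hφ, hf φ hφ, hg φ hφ, neg_add]

theorem HasWeakDeriv.L2_smul {a b : ℝ} {f f' : L2 a b} (c : ℝ) (hf : HasWeakDeriv a b f f') :
    HasWeakDeriv a b (c • f : L2 a b) (c • f' : L2 a b) := by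
  intro φ hφ
  have key : ∀ (χ : ℝ → ℝ) (u : L2 a b),
      ∫ x in Ioo a b, χ x • (c • u : L2 a b) x = c * ∫ x in Ioo a b, χ x • u x := by
    intro χ u
    rw [← integral_const_mul]
    refine integral_congr_ae ?_
    filter_upwards [Lp.coeFn_smul c u] with x hx
    rw [hx, Pi.smul_apply, smul_eq_mul, smul_eq_mul, smul_eq_mul, mul_left_comm]
  rw [key, key, hf φ hφ, mul_neg]

/-- The Sobolev space `H^k(a, b)`: a function `f ∈ L²(a, b)` is recorded together with its weak
derivatives `(f, f', …, f^(k)) ∈ L²(a, b)^(k+1)` (which `f` determines), so that the induced norm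
is the usual one, `‖f‖² = ∑_{i ≤ k} ‖f^(i)‖²_{L²(a, b)}`. -/
def H (k : ℕ) (a b : ℝ) : Submodule ℝ (PiLp 2 (fun _ : Fin (k + 1) => L2 a b)) where
  carrier := {F | ∀ i : Fin k, HasWeakDeriv a b (F i.castSucc) (F i.succ)}
  zero_mem' := fun _ => HasWeakDeriv.L2_zero a b
  add_mem' := fun hF hG i => (hF i).L2_add (hG i)
  smul_mem' := fun c _ hF i => (hF i).L2_smul c

/-- The `i`-th weak derivative `∂ₓ^i f ∈ L²(a, b)` of `f ∈ H^k(a, b)`, for `i ≤ k`. -/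
def H.D {k : ℕ} {a b : ℝ} (i : Fin (k + 1)) (f : H k a b) : L2 a b := f.1 i

/-- `f ∈ L²(0, T; E)`, in the sense of Bochner. -/
def MemL2Time {E : Type*} [NormedAddCommGroup E] (T : ℝ) (f : ℝ → E) : Prop :=
  MemLp f 2 (volume.restrict (Ioo 0 T))

/-- `f ∈ H¹(0, T; E)` with weak time derivative `f'`. -/
def MemH1Time {E : Type*} [NormedAddCommGroup E] [NormedSpace ℝ E]
    (T : ℝ) (f f' : ℝ → E) : Prop :=
  MemL2Time T f ∧ MemL2Time T f' ∧ HasWeakDeriv 0 T f f'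

/-- The boundary values of `f` at `a` and at `b` are zero: `f` has a representative that is
continuous on `[a, b]` and vanishes at both endpoints. -/
def VanishesAtEnds {a b : ℝ} (f : L2 a b) : Prop :=
  ∃ g : ℝ → ℝ, ContinuousOn g (Icc a b) ∧ f =ᵐ[volume.restrict (Ioo a b)] g ∧ g a = 0 ∧ g b = 0

end CarlemanKdVB

/-! Put `θ = 1 / (t (T - t))`, `σ = s θ`, `m = ψ' = 2 L - x` and `u = exp (-σ ψ) q`. Since `L ≤ m ≤
3 L` and `ψ'' = -1`, conjugating the operator by the exponential gives `A u + S u - R u`. Here `A =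
∂ₜ + ∂ₓ³ + 3 (σ m)² ∂ₓ - 3 σ (σ m)` is skew, `S = 3 σ ∂ₓ (m ∂ₓ ·) + (σ m)³` is symmetric, and `R`
collects the conjugated `∂ₓ²` and the term `-σₜ ψ` left by the time derivative.

Pointwise, `2 (A u) (S u) ≤ 2 (A u + S u - R u)² + 2 (R u)²`, so it suffices to bound the cross
product from below. Its spatial part is an exact `x`-derivative plus `9/2 σ u_xx² + 9 σ³ m² u_x² +
(9/2 σ⁵ m⁴ - 3/2 σ³) u²` (`HasPrim.conjugate_product`). The leading coefficients are positive
because `ψ` is concave with slope bounded below, and the boundary terms vanish because `u`, `u_x`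
and `u_xx` do. Its time part `2 uₜ S u` is `∂ₜ ⟪u, S u⟫` up to terms carrying `σₜ`. As `|σₜ| ≤ σ²`
for `s ≥ T`, those terms and `R` are one power of `σ` weaker than the leading ones, and `σ ≥ 4 s /
T²` absorbs them for large `s` (`coercivity`).

The delicate point is `∫ ∂ₜ ⟪u, S u⟫ dt = 0`, as `uₜ` and `S u` are only square integrable. The form
is written as a sum of pairings `⟪r, N⟫` with `⟪r t', N t⟫ = ⟪r t, N t'⟫`. Then the correlation `h ↦
∫ ⟪r (h + t), N t⟫ dt` is even and differentiable, and its derivative at `0`, namely `∫ ⟪r', N⟫`,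
must vanish (`integral_inner_eq_zero_of_ae_symm`). Here `r` vanishes at both ends of `(0, T)`
because the exponential beats every power of `θ`. -/

namespace CarlemanKdVB

/-! ### Calculus of absolutely continuous functions with values in a Banach space. -/

/-- On `[a, b]` the function `f` is a primitive of the integrable function `f'`. -/
def HasPrim {E : Type*} [NormedAddCommGroup E] [NormedSpace ℝ E]
    (a b : ℝ) (f f' : ℝ → E) : Prop :=
  IntegrableOn f' (Ioc a b) ∧ ∀ x ∈ Icc a b, f x = f a + ∫ y in Ioc a x, f' y

namespace HasPrim

variable {E F G : Type*} [NormedAddCommGroup E] [NormedSpace ℝ E]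
  [NormedAddCommGroup F] [NormedSpace ℝ F] [NormedAddCommGroup G] [NormedSpace ℝ G]
  {a b : ℝ}

theorem mono_right {f f' : ℝ → E} (h : HasPrim a b f f') {c : ℝ} (hc : c ≤ b) :
    HasPrim a c f f' :=
  ⟨h.1.mono_set (Ioc_subset_Ioc_right hc), fun x hx => h.2 x ⟨hx.1, hx.2.trans hc⟩⟩

theorem continuousOn {f f' : ℝ → E} (h : HasPrim a b f f') : ContinuousOn f (Icc a b) := by
  have h1 : ContinuousOn (fun x => f a + ∫ y in Ioc a x, f' y) (Icc a b) :=
    continuousOn_const.add (intervalIntegral.continuousOn_primitive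
      ((integrableOn_Icc_iff_integrableOn_Ioc (by simp)).2 h.1))
  exact h1.congr h.2

theorem integrableOn {f f' : ℝ → E} (h : HasPrim a b f f') : IntegrableOn f (Ioc a b) :=
  (h.continuousOn.integrableOn_compact isCompact_Icc).mono_set Ioc_subset_Icc_self

theorem integral_eq {f f' : ℝ → E} (h : HasPrim a b f f') (hab : a ≤ b) :
    ∫ y in Ioc a b, f' y = f b - f a := by
  rw [h.2 b ⟨hab, le_rfl⟩]; abel

theorem congr {f f' g g' : ℝ → E} (h : HasPrim a b f f') (hf : ∀ x ∈ Icc a b, g x = f x)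
    (hf' : ∀ x ∈ Ioc a b, g' x = f' x) : HasPrim a b g g' := by
  refine ⟨h.1.congr_fun (fun x hx => (hf' x hx).symm) measurableSet_Ioc, fun x hx => ?_⟩
  rw [hf x hx, hf a ⟨le_rfl, hx.1.trans hx.2⟩, h.2 x hx]
  congr 1
  exact setIntegral_congr_fun measurableSet_Ioc fun y hy => (hf' y ⟨hy.1, hy.2.trans hx.2⟩).symm

theorem congr_ae {f f' g' : ℝ → E} (h : HasPrim a b f f')
    (hf' : f' =ᵐ[volume.restrict (Ioc a b)] g') : HasPrim a b f g' := by
  refine ⟨h.1.congr hf', fun x hx => ?_⟩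
  rw [h.2 x hx]
  congr 1
  exact integral_congr_ae (ae_restrict_of_ae_restrict_of_subset (Ioc_subset_Ioc_right hx.2) hf')

theorem add {f f' g g' : ℝ → E} (hf : HasPrim a b f f') (hg : HasPrim a b g g') :
    HasPrim a b (fun x => f x + g x) (fun x => f' x + g' x) := by
  refine ⟨hf.1.add hg.1, fun x hx => ?_⟩
  simp only [hf.2 x hx, hg.2 x hx]
  rw [integral_add (hf.mono_right hx.2).1 (hg.mono_right hx.2).1]
  abel

theorem continuousOn_bilin {f f' : ℝ → E} (B : E →L[ℝ] F →L[ℝ] G) {g' : ℝ → F}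
    (hf : HasPrim a b f f') (hg : IntegrableOn g' (Ioc a b)) :
    IntegrableOn (fun x => B (f x) (g' x)) (Ioc a b) := by
  obtain ⟨C, hC⟩ := isCompact_Icc.exists_bound_of_continuousOn hf.continuousOn
  have hm : AEStronglyMeasurable (fun x => B (f x) (g' x)) (volume.restrict (Ioc a b)) := by
    have h1 : AEStronglyMeasurable (fun x => B (f x)) (volume.restrict (Ioc a b)) :=
      B.continuous.comp_aestronglyMeasurable hf.integrableOn.1
    exact isBoundedBilinearMap_apply.continuous.comp_aestronglyMeasurable (h1.prodMk hg.1)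
  refine (hg.norm.const_mul (‖B‖ * C)).mono' hm ?_
  filter_upwards [ae_restrict_mem measurableSet_Ioc] with x hx
  refine (B.le_opNorm₂ _ _).trans ?_
  have := hC x (Ioc_subset_Icc_self hx)
  gcongr

/-- Fubini on the square `(a, b]²`, cut along its diagonal: the two terms on the left are the
integrals of `B (f x) (g y)` over `y ≤ x` and over `x < y`. -/
theorem bilin_integral [CompleteSpace E] [CompleteSpace F] [CompleteSpace G]
    (B : E →L[ℝ] F →L[ℝ] G) {f : ℝ → E} {g : ℝ → F} (hf : IntegrableOn f (Ioc a b))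
    (hg : IntegrableOn g (Ioc a b)) :
    (∫ x in Ioc a b, B (f x) (∫ y in Ioc a x, g y)) +
      (∫ y in Ioc a b, B (∫ x in Ioc a y, f x) (g y)) =
      B (∫ x in Ioc a b, f x) (∫ y in Ioc a b, g y) := by
  set μ : Measure ℝ := volume.restrict (Ioc a b) with hμ
  have hI : Integrable (fun z : ℝ × ℝ => B (f z.1) (g z.2)) (μ.prod μ) :=
    Integrable.op_fst_snd (op := fun x y => B x y)
      (B.continuous₂) ⟨‖B‖, fun x y => B.le_opNorm₂ x y⟩ hf hg
  have hS : MeasurableSet {z : ℝ × ℝ | z.2 ≤ z.1} := measurableSet_le measurable_snd measurable_fst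
  have htot : ∫ z, B (f z.1) (g z.2) ∂(μ.prod μ) = B (∫ x, f x ∂μ) (∫ y, g y ∂μ) := by
    rw [integral_prod _ hI]
    have h1 : ∀ x, ∫ y, B (f x) (g y) ∂μ = B (f x) (∫ y, g y ∂μ) := fun x =>
      (B (f x)).integral_comp_comm hg
    simp_rw [h1]
    exact (B.flip (∫ y, g y ∂μ)).integral_comp_comm hf
  have hle : ∫ z in {z : ℝ × ℝ | z.2 ≤ z.1}, B (f z.1) (g z.2) ∂(μ.prod μ) =
      ∫ x, B (f x) (∫ y in Ioc a x, g y) ∂μ := by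
    rw [← integral_indicator hS, integral_prod _ (hI.indicator hS)]
    refine integral_congr_ae ?_
    filter_upwards [ae_restrict_mem measurableSet_Ioc] with x hx
    have h1 : ∀ y, indicator {z : ℝ × ℝ | z.2 ≤ z.1} (fun z => B (f z.1) (g z.2)) (x, y) =
        indicator (Iic x) (fun y => B (f x) (g y)) y := fun y => by
      by_cases h : y ≤ x <;> simp [indicator, h]
    simp_rw [h1]
    have hset : Iic x ∩ Ioc a b = Ioc a x := by
      ext y; simp only [mem_inter_iff, mem_Iic, mem_Ioc]
      exact ⟨fun h => ⟨h.2.1, h.1⟩, fun h => ⟨h.2, h.1, h.2.trans hx.2⟩⟩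
    rw [integral_indicator measurableSet_Iic, hμ, Measure.restrict_restrict measurableSet_Iic, hset]
    exact (B (f x)).integral_comp_comm (hg.mono_set (Ioc_subset_Ioc_right hx.2))
  have hgt : ∫ z in {z : ℝ × ℝ | z.2 ≤ z.1}ᶜ, B (f z.1) (g z.2) ∂(μ.prod μ) =
      ∫ y, B (∫ x in Ioc a y, f x) (g y) ∂μ := by
    rw [← integral_indicator hS.compl, integral_prod_symm _ (hI.indicator hS.compl)]
    refine integral_congr_ae ?_
    filter_upwards [ae_restrict_mem measurableSet_Ioc] with y hy
    have h1 : ∀ x, indicator {z : ℝ × ℝ | z.2 ≤ z.1}ᶜ (fun z => B (f z.1) (g z.2)) (x, y) =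
        indicator (Iio y) (fun x => B (f x) (g y)) x := fun x => by
      by_cases h : x < y
      · simp [indicator, h]
      · simp [indicator, h, not_lt.1 h]
    simp_rw [h1]
    have hset : Iio y ∩ Ioc a b = Ioo a y := by
      ext x; simp only [mem_inter_iff, mem_Iio, mem_Ioc, mem_Ioo]
      exact ⟨fun h => ⟨h.2.1, h.1⟩, fun h => ⟨h.2, h.1, h.2.le.trans hy.2⟩⟩
    rw [integral_indicator measurableSet_Iio, hμ, Measure.restrict_restrict measurableSet_Iio, hset,
      ← integral_Ioc_eq_integral_Ioo]
    exact (B.flip (g y)).integral_comp_comm (hf.mono_set (Ioc_subset_Ioc_right hy.2))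
  rw [← hle, ← hgt, ← htot, integral_add_compl hS hI]

/-- The product rule without pointwise differentiability. Each factor is written as its initial
value plus a primitive, and `bilin_integral` recombines the two terms that contain double integrals.
-/
theorem bilin [CompleteSpace E] [CompleteSpace F] [CompleteSpace G]
    (B : E →L[ℝ] F →L[ℝ] G) {f f' : ℝ → E} {g g' : ℝ → F} (hf : HasPrim a b f f')
    (hg : HasPrim a b g g') :
    HasPrim a b (fun x => B (f x) (g x)) (fun x => B (f' x) (g x) + B (f x) (g' x)) := by
  have i1 : IntegrableOn (fun x => B (f' x) (g x)) (Ioc a b) :=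
    hg.continuousOn_bilin B.flip hf.1
  have i2 : IntegrableOn (fun x => B (f x) (g' x)) (Ioc a b) := hf.continuousOn_bilin B hg.1
  refine ⟨i1.add i2, fun x hx => ?_⟩
  have hf := hf.mono_right hx.2
  have hg := hg.mono_right hx.2
  have i1 := i1.mono_set (Ioc_subset_Ioc_right hx.2)
  have i2 := i2.mono_set (Ioc_subset_Ioc_right hx.2)
  rw [integral_add i1 i2]
  have e1 : ∫ y in Ioc a x, B (f' y) (g y) =
      B (∫ y in Ioc a x, f' y) (g a) + ∫ y in Ioc a x, B (f' y) (∫ z in Ioc a y, g' z) := by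
    have : ∫ y in Ioc a x, B (f' y) (g y) =
        ∫ y in Ioc a x, (B.flip (g a) (f' y) + B (f' y) (∫ z in Ioc a y, g' z)) :=
      setIntegral_congr_fun measurableSet_Ioc fun y hy => by
        simp only [hg.2 y (Ioc_subset_Icc_self hy), map_add, ContinuousLinearMap.flip_apply]
    have j1 : IntegrableOn (fun y => B.flip (g a) (f' y)) (Ioc a x) :=
      (B.flip (g a)).integrable_comp hf.1
    rw [this, integral_add j1, (B.flip (g a)).integral_comp_comm hf.1,
      ContinuousLinearMap.flip_apply]
    refine (i1.sub j1).congr ?_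
    filter_upwards [ae_restrict_mem measurableSet_Ioc] with y hy
    simp [hg.2 y (Ioc_subset_Icc_self hy)]
  have e2 : ∫ y in Ioc a x, B (f y) (g' y) =
      B (f a) (∫ y in Ioc a x, g' y) + ∫ y in Ioc a x, B (∫ z in Ioc a y, f' z) (g' y) := by
    have : ∫ y in Ioc a x, B (f y) (g' y) =
        ∫ y in Ioc a x, (B (f a) (g' y) + B (∫ z in Ioc a y, f' z) (g' y)) :=
      setIntegral_congr_fun measurableSet_Ioc fun y hy => by
        simp only [hf.2 y (Ioc_subset_Icc_self hy), map_add, add_apply]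
    have j1 : IntegrableOn (fun y => B (f a) (g' y)) (Ioc a x) :=
      (B (f a)).integrable_comp hg.1
    rw [this, integral_add j1, (B (f a)).integral_comp_comm hg.1]
    refine (i2.sub j1).congr ?_
    filter_upwards [ae_restrict_mem measurableSet_Ioc] with y hy
    simp [hf.2 y (Ioc_subset_Icc_self hy)]
  rw [e1, e2]
  simp only [hf.2 x ⟨hx.1, le_rfl⟩, hg.2 x ⟨hx.1, le_rfl⟩]
  simp only [map_add, add_apply]
  rw [← bilin_integral B hf.1 hg.1]
  abel

theorem mul {f f' g g' : ℝ → ℝ} (hf : HasPrim a b f f') (hg : HasPrim a b g g') :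
    HasPrim a b (fun x => f x * g x) (fun x => f' x * g x + f x * g' x) :=
  hf.bilin (ContinuousLinearMap.mul ℝ ℝ) hg

theorem of_hasDerivAt [CompleteSpace E] {f f' : ℝ → E} (h : ∀ x ∈ Icc a b, HasDerivAt f (f' x) x)
    (hc : ContinuousOn f' (Icc a b)) : HasPrim a b f f' := by
  have hi : IntegrableOn f' (Ioc a b) :=
    (hc.integrableOn_compact isCompact_Icc).mono_set Ioc_subset_Icc_self
  refine ⟨hi, fun x hx => ?_⟩
  rw [← intervalIntegral.integral_of_le hx.1, intervalIntegral.integral_eq_sub_of_hasDerivAt]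
  · abel
  · intro y hy
    rw [uIcc_of_le hx.1] at hy
    exact h y ⟨hy.1, hy.2.trans hx.2⟩
  · rw [intervalIntegrable_iff_integrableOn_Ioc_of_le hx.1]
    exact hi.mono_set (Ioc_subset_Ioc_right hx.2)

theorem const (c : E) : HasPrim a b (fun _ => c) (fun _ => 0) := by
  refine ⟨integrableOn_zero, fun x hx => ?_⟩
  simp

theorem const_mul {f f' : ℝ → ℝ} (c : ℝ) (hf : HasPrim a b f f') :
    HasPrim a b (fun x => c * f x) (fun x => c * f' x) :=
  ((const c).mul hf).congr (fun _ _ => rfl) (fun _ _ => by simp)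

theorem primitive {f' : ℝ → E} (hf : IntegrableOn f' (Ioc a b)) (c : E) :
    HasPrim a b (fun x => c + ∫ y in Ioc a x, f' y) f' :=
  ⟨hf, fun x _ => by simp⟩

end HasPrim

/-! ### Weak derivatives in one variable and their absolutely continuous representatives. -/

section WeakDerivative

theorem IsTestFunction.integrableOn_smul {E : Type*} [NormedAddCommGroup E] [NormedSpace ℝ E]
    {a b : ℝ} {φ : ℝ → ℝ} (hφ : IsTestFunction a b φ) {f : ℝ → E}
    (hf : IntegrableOn f (Ioo a b)) : IntegrableOn (fun x => φ x • f x) (Ioo a b) := by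
  obtain ⟨C, hC⟩ := hφ.1.continuous.bounded_above_of_compact_support hφ.2.1
  exact hf.bdd_smul C hφ.1.continuous.aestronglyMeasurable (Filter.Eventually.of_forall hC)

variable {E : Type*} [NormedAddCommGroup E] [NormedSpace ℝ E] [CompleteSpace E] {a b : ℝ}

theorem IsTestFunction.eq_zero_left {φ : ℝ → ℝ} (hφ : IsTestFunction a b φ) : φ a = 0 :=
  image_eq_zero_of_notMem_tsupport fun h => lt_irrefl a (hφ.2.2 h).1

theorem IsTestFunction.eq_zero_right {φ : ℝ → ℝ} (hφ : IsTestFunction a b φ) : φ b = 0 :=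
  image_eq_zero_of_notMem_tsupport fun h => lt_irrefl b (hφ.2.2 h).2

theorem IsTestFunction.hasPrim {φ : ℝ → ℝ} (hφ : IsTestFunction a b φ) :
    HasPrim a b φ (_root_.deriv φ) :=
  HasPrim.of_hasDerivAt
    (fun x _ => ((hφ.1.differentiable (by simp)) x).hasDerivAt) hφ.deriv.1.continuous.continuousOn

/-- Integration by parts: the product with a test function vanishes at both ends. -/
theorem HasPrim.hasWeakDeriv {f g : ℝ → E} (hab : a ≤ b) (h : HasPrim a b f g) :
    HasWeakDeriv a b f g := by
  intro φ hφ
  have h1 := (hφ.hasPrim.bilin (ContinuousLinearMap.lsmul ℝ ℝ) h)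
  have h2 := h1.integral_eq hab
  simp only [ContinuousLinearMap.lsmul_apply, hφ.eq_zero_left, hφ.eq_zero_right, zero_smul,
    sub_zero] at h2
  have i1 : IntegrableOn (fun x => _root_.deriv φ x • f x) (Ioc a b) :=
    h.continuousOn_bilin (ContinuousLinearMap.lsmul ℝ ℝ).flip hφ.hasPrim.1
  have i2 : IntegrableOn (fun x => φ x • g x) (Ioc a b) :=
    hφ.hasPrim.continuousOn_bilin (ContinuousLinearMap.lsmul ℝ ℝ) h.1
  rw [integral_add i1 i2] at h2
  rw [← integral_Ioc_eq_integral_Ioo, ← integral_Ioc_eq_integral_Ioo]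
  exact eq_neg_of_add_eq_zero_left h2

/-- A test function of integral zero is the derivative of a test function. -/
theorem IsTestFunction.exists_primitive {φ : ℝ → ℝ} (hφ : IsTestFunction a b φ)
    (h0 : ∫ x in Ioo a b, φ x = 0) : ∃ Φ, IsTestFunction a b Φ ∧ _root_.deriv Φ = φ := by
  by_cases hne : (tsupport φ).Nonempty
  swap
  · have hz : φ = 0 := by
      rw [not_nonempty_iff_eq_empty, tsupport_eq_empty_iff] at hne
      exact hne
    exact ⟨0, ⟨contDiff_const, HasCompactSupport.zero, by simp [tsupport]⟩, by
      rw [hz]; funext x; simp⟩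
  obtain ⟨c, hc, hcm⟩ := hφ.2.1.exists_isLeast hne
  obtain ⟨d, hd, hdm⟩ := hφ.2.1.exists_isGreatest hne
  have hcab := hφ.2.2 hc
  have hdab := hφ.2.2 hd
  have hcont := hφ.1.continuous
  set Φ : ℝ → ℝ := fun x => ∫ y in a..x, φ y with hΦ
  have hder : ∀ x, HasDerivAt Φ (φ x) x := fun x =>
    intervalIntegral.integral_hasDerivAt_right (hcont.intervalIntegrable _ _)
      (hcont.stronglyMeasurableAtFilter _ _) hcont.continuousAt
  have hderiv : _root_.deriv Φ = φ := funext fun x => (hder x).deriv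
  have hlow : ∀ y, y < c → φ y = 0 := fun y hy =>
    image_eq_zero_of_notMem_tsupport fun h => absurd (hcm h) (not_le.2 hy)
  have hhigh : ∀ y, d < y → φ y = 0 := fun y hy =>
    image_eq_zero_of_notMem_tsupport fun h => absurd (hdm h) (not_le.2 hy)
  have htot : ∫ y in a..b, φ y = 0 := by
    rw [intervalIntegral.integral_of_le (hcab.1.le.trans hcab.2.le), integral_Ioc_eq_integral_Ioo,
      h0]
  have hsupp : tsupport Φ ⊆ Icc c d := by
    refine closure_minimal (fun x hx => ?_) isClosed_Icc
    by_contra hnot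
    apply hx
    rw [mem_Icc, not_and_or, not_le, not_le] at hnot
    rcases hnot with h | h
    · refine intervalIntegral.integral_zero_ae (Filter.Eventually.of_forall fun y hy => hlow y ?_)
      rcases mem_uIoc.1 hy with h' | h'
      · exact h'.2.trans_lt h
      · exact h'.2.trans_lt hcab.1
    -- To the right of the support the primitive equals the total integral, which is zero by
    -- hypothesis.
    · have h1 := intervalIntegral.integral_add_adjacent_intervals
        (hcont.intervalIntegrable (μ := volume) a b) (hcont.intervalIntegrable (μ := volume) b x)
      rw [hΦ]
      simp only
      rw [← h1, htot, zero_add]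
      refine intervalIntegral.integral_zero_ae (Filter.Eventually.of_forall fun y hy => hhigh y ?_)
      rcases mem_uIoc.1 hy with h' | h'
      · exact hdab.2.trans h'.1
      · exact h.trans h'.1
  refine ⟨Φ, ⟨?_, ?_, hsupp.trans fun x hx => ⟨hcab.1.trans_le hx.1, hx.2.trans_lt hdab.2⟩⟩, hderiv⟩
  · rw [contDiff_infty_iff_deriv, hderiv]
    exact ⟨fun x => (hder x).differentiableAt, hφ.1⟩
  · exact HasCompactSupport.of_support_subset_isCompact isCompact_Icc
      (subset_closure.trans hsupp)

theorem IsTestFunction.exists_integral_eq_one (hab : a < b) :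
    ∃ φ, IsTestFunction a b φ ∧ ∫ x in Ioo a b, φ x = 1 := by
  have hmem : (a + b) / 2 ∈ Ioo a b := ⟨by linarith, by linarith⟩
  obtain ⟨f, hf, hfc, hfd, hfr, hf1⟩ :=
    exists_contDiff_tsupport_subset (n := ⊤) (isOpen_Ioo.mem_nhds hmem)
  have hfi : Integrable f := hfd.continuous.integrable_of_hasCompactSupport hfc
  have hpos : 0 < ∫ x, f x :=
    hfd.continuous.integral_pos_of_hasCompactSupport_nonneg_nonzero hfc
      (fun x => (hfr (mem_range_self x)).1) (x := (a + b) / 2) (by rw [hf1]; exact one_ne_zero)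
  have heq : ∫ x in Ioo a b, f x = ∫ x, f x :=
    setIntegral_eq_integral_of_forall_compl_eq_zero fun x hx =>
      image_eq_zero_of_notMem_tsupport fun h => hx (hf h)
  refine ⟨fun x => (∫ x, f x)⁻¹ * f x, ⟨contDiff_const.mul hfd, hfc.mul_left, ?_⟩, ?_⟩
  · exact (tsupport_mul_subset_right).trans hf
  · rw [integral_const_mul, heq, inv_mul_cancel₀ hpos.ne']

theorem IsTestFunction.sub_smul {φ χ : ℝ → ℝ} (hφ : IsTestFunction a b φ)
    (hχ : IsTestFunction a b χ) (c : ℝ) : IsTestFunction a b (fun x => φ x - c * χ x) := by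
  have h1 : tsupport (fun x => φ x - c * χ x) ⊆ tsupport φ ∪ tsupport χ := by
    refine closure_minimal (fun x hx => ?_) ((isClosed_tsupport _).union (isClosed_tsupport _))
    by_contra hnot
    rw [mem_union, not_or] at hnot
    apply hx
    simp [image_eq_zero_of_notMem_tsupport hnot.1, image_eq_zero_of_notMem_tsupport hnot.2]
  refine ⟨hφ.1.sub (contDiff_const.mul hχ.1), ?_, h1.trans (union_subset hφ.2.2 hχ.2.2)⟩
  exact HasCompactSupport.of_support_subset_isCompact (hφ.2.1.union hχ.2.1)
    (subset_closure.trans h1)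

/-- Du Bois-Reymond: a function whose weak derivative vanishes is a constant. -/
theorem HasWeakDeriv.ae_eq_const (hab : a < b) {f : ℝ → E} (hf : IntegrableOn f (Ioo a b))
    (h : HasWeakDeriv a b f (fun _ => 0)) : ∃ c, f =ᵐ[volume.restrict (Ioo a b)] fun _ => c := by
  obtain ⟨χ, hχ, hχ1⟩ := IsTestFunction.exists_integral_eq_one hab
  set c : E := ∫ x in Ioo a b, χ x • f x with hc
  refine ⟨c, ?_⟩
  have hconst : IntegrableOn (fun _ : ℝ => c) (Ioo a b) := integrableOn_const (by simp)
  have key : ∀ g : ℝ → ℝ, ContDiff ℝ ∞ g → HasCompactSupport g → tsupport g ⊆ Ioo a b →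
      ∫ x, g x • (f x - c) = 0 := by
    intro g hg1 hg2 hg3
    have hg : IsTestFunction a b g := ⟨hg1, hg2, hg3⟩
    have hgi : IntegrableOn g (Ioo a b) :=
      (hg.1.continuous.integrable_of_hasCompactSupport hg.2.1).integrableOn
    have hχi : IntegrableOn χ (Ioo a b) :=
      (hχ.1.continuous.integrable_of_hasCompactSupport hχ.2.1).integrableOn
    set I : ℝ := ∫ x in Ioo a b, g x with hI
    -- Subtracting `I χ` makes the integral zero, so the difference is the derivative of a test
    -- function. The hypothesis then gives `∫ g f = I c = ∫ g c`.
    have h0 : ∫ x in Ioo a b, (g x - I * χ x) = 0 := by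
      rw [integral_sub hgi (hχi.const_mul I), integral_const_mul, hχ1, ← hI]; ring
    obtain ⟨Φ, hΦ, hΦd⟩ := (hg.sub_smul hχ I).exists_primitive h0
    have h1 := h Φ hΦ
    rw [hΦd] at h1
    simp only [sub_smul, smul_zero, integral_zero, neg_zero, mul_smul] at h1
    rw [integral_sub (hg.integrableOn_smul hf) (Integrable.fun_smul I (hχ.integrableOn_smul hf)),
      integral_smul, ← hc] at h1
    have h2 : ∫ x, g x • (f x - c) = ∫ x in Ioo a b, g x • (f x - c) :=
      (setIntegral_eq_integral_of_forall_compl_eq_zero fun x hx => by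
        rw [image_eq_zero_of_notMem_tsupport fun h => hx (hg3 h), zero_smul]).symm
    rw [h2]
    simp only [smul_sub]
    rw [integral_sub (hg.integrableOn_smul hf) (hg.integrableOn_smul hconst),
      integral_smul_const, ← hI]
    exact h1
  have h3 := isOpen_Ioo.ae_eq_zero_of_integral_contDiff_smul_eq_zero
    (μ := volume) (U := Ioo a b) (f := fun x => f x - c)
    ((hf.sub hconst).locallyIntegrableOn) key
  rw [Filter.EventuallyEq, ae_restrict_iff' measurableSet_Ioo]
  filter_upwards [h3] with x hx hmem
  exact sub_eq_zero.1 (hx hmem)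

/-- The primitive of `g` has the same weak derivative as `f`, so it differs from `f` by a constant.
The lemma serves twice: in `x` for real functions, and in `t` for functions with values in `L2`. -/
theorem HasWeakDeriv.exists_hasPrim (hab : a < b) {f g : ℝ → E} (hf : IntegrableOn f (Ioo a b))
    (hg : IntegrableOn g (Ioo a b)) (h : HasWeakDeriv a b f g) :
    ∃ F, HasPrim a b F g ∧ f =ᵐ[volume.restrict (Ioo a b)] F := by
  have hg' : IntegrableOn g (Ioc a b) := (integrableOn_Ioc_iff_integrableOn_Ioo (by simp)).2 hg
  have hp := HasPrim.primitive hg' (0 : E)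
  set P : ℝ → E := fun x => 0 + ∫ y in Ioc a x, g y with hP
  have hPi : IntegrableOn P (Ioo a b) := hp.integrableOn.mono_set Ioo_subset_Ioc_self
  have hw : HasWeakDeriv a b (fun x => f x - P x) (fun _ => 0) := by
    intro φ hφ
    have h1 := h φ hφ
    have h2 := hp.hasWeakDeriv hab.le φ hφ
    simp only [smul_sub, smul_zero, integral_zero, neg_zero]
    rw [integral_sub (hφ.deriv.integrableOn_smul hf) (hφ.deriv.integrableOn_smul hPi), h1, h2,
      sub_self]
  obtain ⟨c, hc⟩ := hw.ae_eq_const hab (hf.sub hPi)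
  refine ⟨fun x => c + ∫ y in Ioc a x, g y, HasPrim.primitive hg' c, ?_⟩
  filter_upwards [hc] with x hx
  rw [← hx, hP]
  simp

end WeakDerivative

/-! ### Vanishing of `∫ ⟪r', N⟫` for symmetric pairings. -/

section SymmetricPairing

variable {X : Type*} [NormedAddCommGroup X] [InnerProductSpace ℝ X]

theorem integrable_inner_of_memLp {α : Type*} {mα : MeasurableSpace α} {μ : Measure α}
    {f g : α → X} (hf : MemLp f 2 μ) (hg : MemLp g 2 μ) :
    Integrable (fun x => inner ℝ (f x) (g x)) μ :=
  (hf.norm.integrable_mul hg.norm).mono' (hf.1.inner hg.1)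
    (Filter.Eventually.of_forall fun _ => norm_inner_le_norm _ _)

theorem integrable_inner_translate {f g : ℝ → X} (hf : MemLp f 2 volume) (hg : MemLp g 2 volume)
    (h : ℝ) : Integrable (fun t => inner ℝ (f (h + t)) (g t)) :=
  integrable_inner_of_memLp
    (hf.comp_measurePreserving (measurePreserving_add_left volume h)) hg

/-- Translation is continuous in `L²`. -/
theorem continuous_integral_inner_translate {f g : ℝ → X} (hf : MemLp f 2 volume)
    (hg : MemLp g 2 volume) : Continuous fun h : ℝ => ∫ t, inner ℝ (f (h + t)) (g t) := by
  let τ : ℝ → C(ℝ, ℝ) := fun h => ⟨fun t => h + t, by fun_prop⟩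
  have hτ : Continuous τ :=
    (ContinuousMap.curry ⟨fun p : ℝ × ℝ => p.1 + p.2, by fun_prop⟩).continuous
  have hmp : ∀ h, MeasurePreserving (τ h) volume volume := fun h =>
    measurePreserving_add_left volume h
  have hc : Continuous fun h => Lp.compMeasurePreserving (τ h) (hmp h) hf.toLp :=
    Continuous.compMeasurePreservingLp continuous_const hτ hmp (by simp)
  have h2 : Continuous fun h =>
      inner ℝ (Lp.compMeasurePreserving (τ h) (hmp h) hf.toLp) hg.toLp := hc.inner continuous_const
  convert h2 using 2 with h
  rw [L2.inner_def]
  refine integral_congr_ae ?_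
  have e1 := Lp.coeFn_compMeasurePreserving hf.toLp (hmp h)
  have e2 := (hmp h).quasiMeasurePreserving.ae_eq_comp hf.coeFn_toLp
  filter_upwards [e1, e2, hg.coeFn_toLp] with t h1 h2 h3
  rw [h1, h2, h3]
  rfl

/-- Justifies Fubini for the correlation: the shear `(h, t) ↦ (h, h + t)` preserves the product
measure, and the integrand is dominated by the sum of the two squared norms. -/
theorem integrable_prod_inner_translate {f g : ℝ → X} (hf : MemLp f 2 volume)
    (hg : MemLp g 2 volume) {s : Set ℝ} (hs : volume s < ⊤) :
    Integrable (fun z : ℝ × ℝ => inner ℝ (f (z.1 + z.2)) (g z.2))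
      ((volume.restrict s).prod volume) := by
  have : IsFiniteMeasure (volume.restrict s) := ⟨by simpa using hs⟩
  have hmp := measurePreserving_prod_add (volume.restrict s) (volume : Measure ℝ)
  have hf2 : Integrable (fun t => ‖f t‖ ^ 2) volume := hf.integrable_norm_pow (by norm_num)
  have hg2 : Integrable (fun t => ‖g t‖ ^ 2) volume := hg.integrable_norm_pow (by norm_num)
  have i1 : Integrable (fun z : ℝ × ℝ => ‖f (z.1 + z.2)‖ ^ 2)
      ((volume.restrict s).prod volume) :=
    hmp.integrable_comp_of_integrable (hf2.comp_snd (volume.restrict s))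
  have i2 : Integrable (fun z : ℝ × ℝ => ‖g z.2‖ ^ 2) ((volume.restrict s).prod volume) :=
    hg2.comp_snd (volume.restrict s)
  have m1 : AEStronglyMeasurable (fun z : ℝ × ℝ => f (z.1 + z.2))
      ((volume.restrict s).prod volume) :=
    (hf.1.comp_snd (μ := volume.restrict s)).comp_measurePreserving hmp
  have m2 : AEStronglyMeasurable (fun z : ℝ × ℝ => g z.2) ((volume.restrict s).prod volume) :=
    hg.1.comp_snd
  refine (i1.add i2).mono' (m1.inner m2) (Filter.Eventually.of_forall fun z => ?_)
  refine (norm_inner_le_norm _ _).trans ?_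
  simp only [Pi.add_apply]
  nlinarith [sq_nonneg (‖f (z.1 + z.2)‖ - ‖g z.2‖), sq_nonneg (‖f (z.1 + z.2)‖),
    sq_nonneg ‖g z.2‖]

/-- As `r` vanishes at both ends, its extension by zero has no jump and remains a primitive on the
whole line, where translations act. -/
theorem HasPrim.indicator_sub {T : ℝ} (hT : 0 ≤ T) {r r' : ℝ → X} (h : HasPrim 0 T r r')
    (h0 : r 0 = 0) (h1 : r T = 0) (x y : ℝ) :
    (Ioc 0 T).indicator r y - (Ioc 0 T).indicator r x =
      ∫ z in x..y, (Ioc 0 T).indicator r' z := by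
  have hi : Integrable ((Ioc 0 T).indicator r') := h.1.integrable_indicator measurableSet_Ioc
  have key : ∀ t, (Ioc 0 T).indicator r t = ∫ z in Iic t, (Ioc 0 T).indicator r' z := by
    intro t
    rw [setIntegral_indicator measurableSet_Ioc]
    rcases le_or_gt t 0 with ht | ht
    · have : Iic t ∩ Ioc 0 T = ∅ := by
        ext z; simp only [mem_inter_iff, mem_Iic, mem_Ioc, mem_empty_iff_false, iff_false]
        rintro ⟨a, b, -⟩; linarith
      rw [this, indicator_of_notMem fun hm => not_lt.2 ht hm.1]; simp
    · rcases le_or_gt t T with ht' | ht'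
      · have : Iic t ∩ Ioc 0 T = Ioc 0 t := by
          ext z; simp only [mem_inter_iff, mem_Iic, mem_Ioc]
          exact ⟨fun a => ⟨a.2.1, a.1⟩, fun a => ⟨a.2, a.1, a.2.trans ht'⟩⟩
        rw [this, indicator_of_mem (show t ∈ Ioc 0 T from ⟨ht, ht'⟩), h.2 t ⟨ht.le, ht'⟩, h0,
          zero_add]
      · have : Iic t ∩ Ioc 0 T = Ioc 0 T := by
          ext z; simp only [mem_inter_iff, mem_Iic, mem_Ioc]
          exact ⟨fun a => a.2, fun a => ⟨a.2.trans ht'.le, a⟩⟩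
        rw [this, indicator_of_notMem fun hm => not_lt.2 hm.2 ht', h.integral_eq hT, h0, h1,
          sub_zero]
  rw [key, key, intervalIntegral.integral_Iic_sub_Iic hi.integrableOn hi.integrableOn]

variable [CompleteSpace X]

/-- If the correlation `h ↦ ∫ ⟪r (h + t), N t⟫` is even, its derivative at `0` vanishes. -/
theorem integral_inner_eq_zero_of_ae_symm {r r' N : ℝ → X}
    (hr : ∀ x y, r y - r x = ∫ z in x..y, r' z) (hr2 : MemLp r 2 volume)
    (hr'2 : MemLp r' 2 volume) (hN : MemLp N 2 volume) (hr' : Integrable r')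
    {S : Set ℝ} (hS : ∀ᵐ t, t ∈ S)
    (hsymm : ∀ t ∈ S, ∀ t' ∈ S, (inner ℝ (r t') (N t) : ℝ) = inner ℝ (r t) (N t')) :
    ∫ t, (inner ℝ (r' t) (N t) : ℝ) = 0 := by
  set c : ℝ → ℝ := fun h => ∫ t, inner ℝ (r (h + t)) (N t) with hc
  set e : ℝ → ℝ := fun h => ∫ t, inner ℝ (r' (h + t)) (N t) with he
  have hce : ∀ h, c h - c 0 = ∫ σ in (0 : ℝ)..h, e σ := by
    intro h
    rw [hc, he]
    simp only
    rw [← integral_sub (integrable_inner_translate hr2 hN h) (integrable_inner_translate hr2 hN 0),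
      intervalIntegral_integral_swap]
    · refine integral_congr_ae (Filter.Eventually.of_forall fun t => ?_)
      simp only
      rw [← inner_sub_left, hr, ← intervalIntegral.integral_comp_add_right]
      have := ContinuousLinearMap.intervalIntegral_comp_comm (innerSL ℝ (N t))
        (f := fun σ => r' (σ + t)) (μ := volume) (a := 0) (b := h)
        ((hr'.comp_add_right t).intervalIntegrable)
      simp only [innerSL_apply_apply] at this
      rw [real_inner_comm, ← this]
      simp_rw [real_inner_comm]
    · exact integrable_prod_inner_translate hr'2 hN (by simp [uIoc])
  have hder : HasDerivAt c (e 0) 0 := by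
    have hcont : Continuous e := continuous_integral_inner_translate hr'2 hN
    have h1 := (intervalIntegral.integral_hasDerivAt_right (hcont.intervalIntegrable 0 0)
      (hcont.stronglyMeasurableAtFilter _ _) hcont.continuousAt).add_const (c 0)
    have h2 : c = fun h => (∫ σ in (0 : ℝ)..h, e σ) + c 0 := by
      funext h
      rw [← hce]; ring
    rwa [← h2] at h1
  have heven : ∀ h, c (-h) = c h := by
    intro h
    rw [hc]
    simp only
    -- Translate the variable by `h` to move the shift from `r` to `N`; the symmetry then moves it
    -- back to `r` with the opposite sign.
    rw [← integral_add_left_eq_self (fun t => (inner ℝ (r (-h + t)) (N t) : ℝ)) h]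
    refine integral_congr_ae ?_
    have hS' : ∀ᵐ t, h + t ∈ S :=
      (measurePreserving_add_left volume h).quasiMeasurePreserving.ae hS
    filter_upwards [hS, hS'] with t h1 h2
    rw [neg_add_cancel_left, hsymm _ h2 _ h1]
  have hder' : HasDerivAt c (-(e 0)) 0 := by
    have h1 : HasDerivAt (fun h => c (-h)) (-(e 0)) 0 := by
      have h2 : HasDerivAt c (e 0) (-0) := by rwa [neg_zero]
      have h3 := h2.comp (0 : ℝ) (hasDerivAt_neg (0 : ℝ))
      rwa [mul_neg_one] at h3
    simpa only [heven] using h1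
  have h0 : e 0 = 0 := by linarith [hder.unique hder']
  simpa [he] using h0

theorem HasPrim.integral_inner_eq_zero {T : ℝ} (hT : 0 ≤ T) {r r' N : ℝ → X}
    (h : HasPrim 0 T r r') (h0 : r 0 = 0) (h1 : r T = 0)
    (hr' : MemLp r' 2 (volume.restrict (Ioo 0 T))) (hN : MemLp N 2 (volume.restrict (Ioo 0 T)))
    {S : Set ℝ} (hS : ∀ᵐ t ∂(volume.restrict (Ioo 0 T)), t ∈ S)
    (hsymm : ∀ t ∈ S, ∀ t' ∈ S, (inner ℝ (r t') (N t) : ℝ) = inner ℝ (r t) (N t')) :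
    ∫ t in Ioo 0 T, (inner ℝ (r' t) (N t) : ℝ) = 0 := by
  rw [Measure.restrict_congr_set Ioo_ae_eq_Ioc] at hr' hN hS ⊢
  set I := Ioc (0 : ℝ) T with hI
  have hr : MemLp r 2 (volume.restrict I) := by
    obtain ⟨C, hC⟩ := isCompact_Icc.exists_bound_of_continuousOn h.continuousOn
    refine MemLp.of_bound h.integrableOn.1 C ?_
    filter_upwards [ae_restrict_mem measurableSet_Ioc] with x hx
    exact hC x (Ioc_subset_Icc_self hx)
  have e : ∫ t in I, (inner ℝ (r' t) (N t) : ℝ) =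
      ∫ t, (inner ℝ (I.indicator r' t) (I.indicator N t) : ℝ) := by
    rw [← integral_indicator (show MeasurableSet I from measurableSet_Ioc)]
    congr 1
    funext t
    by_cases ht : t ∈ I
    · simp only [indicator_of_mem ht]
    · simp only [indicator_of_notMem ht, inner_zero_left]
  rw [e]
  refine integral_inner_eq_zero_of_ae_symm (r := I.indicator r) (h.indicator_sub hT h0 h1)
    ((memLp_indicator_iff_restrict measurableSet_Ioc).2 hr)
    ((memLp_indicator_iff_restrict measurableSet_Ioc).2 hr')
    ((memLp_indicator_iff_restrict measurableSet_Ioc).2 hN)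
    (h.1.integrable_indicator measurableSet_Ioc)
    (S := {t | t ∈ I → t ∈ S}) ((ae_restrict_iff' measurableSet_Ioc).1 hS) ?_
  -- When one of the two times lies outside the interval, both pairings are zero.
  intro t ht t' ht'
  by_cases a : t ∈ I <;> by_cases b : t' ∈ I
  · simp only [indicator_of_mem a, indicator_of_mem b]
    exact hsymm t (ht a) t' (ht' b)
  all_goals simp only [indicator_of_mem, indicator_of_notMem, a, b, not_false_iff,
    inner_zero_left, inner_zero_right]

end SymmetricPairing

/-! ### Pointwise algebra: absorption of the lower order terms. -/

section Coercivity

variable {L σ m β ψ a b c : ℝ}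

/-- The square of `R u`, with `a`, `b`, `c` standing for `u`, `u_x`, `u_xx` and `β` for `σₜ`. The
factor `4` counts the terms; the other constants come from `m ≤ 3 L`, `|β| ≤ σ²` and `ψ ≤ 5 L²`. -/
theorem lowerOrder_sq_le (hm0 : 0 ≤ m) (hm : m ≤ 3 * L) (hσ : 1 ≤ σ)
    (hβ : |β| ≤ σ ^ 2) (hψ0 : 0 ≤ ψ) (hψ : ψ ≤ 5 * L ^ 2) :
    (c + 2 * σ * m * b + (σ ^ 2 * m ^ 2 - σ) * a - β * ψ * a) ^ 2 ≤
      4 * (1 + 36 * L ^ 2 + (9 * L ^ 2 + 1) ^ 2 + 25 * L ^ 4) *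
        (c ^ 2 + σ ^ 2 * b ^ 2 + σ ^ 4 * a ^ 2) := by
  have hm2 : m ^ 2 ≤ 9 * L ^ 2 := by nlinarith
  have hσ2 : σ ≤ σ ^ 2 := by nlinarith
  have h1 : (2 * σ * m * b) ^ 2 ≤ 36 * L ^ 2 * (σ ^ 2 * b ^ 2) := by
    have : 0 ≤ σ ^ 2 * b ^ 2 := by positivity
    nlinarith
  have h2 : ((σ ^ 2 * m ^ 2 - σ) * a) ^ 2 ≤ (9 * L ^ 2 + 1) ^ 2 * (σ ^ 4 * a ^ 2) := by
    have h3 : |σ ^ 2 * m ^ 2 - σ| ≤ (9 * L ^ 2 + 1) * σ ^ 2 := by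
      rw [abs_le]
      constructor
      · nlinarith [mul_nonneg (sq_nonneg σ) (sq_nonneg m), mul_nonneg (sq_nonneg σ) (sq_nonneg L)]
      · nlinarith [mul_nonneg (sq_nonneg σ) (sub_nonneg.2 hm2), sq_nonneg σ]
    have h4 := sq_le_sq'
      (by linarith [abs_nonneg (σ ^ 2 * m ^ 2 - σ), neg_abs_le (σ ^ 2 * m ^ 2 - σ)])
      ((le_abs_self _).trans h3)
    calc ((σ ^ 2 * m ^ 2 - σ) * a) ^ 2 = (σ ^ 2 * m ^ 2 - σ) ^ 2 * a ^ 2 := by ring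
      _ ≤ ((9 * L ^ 2 + 1) * σ ^ 2) ^ 2 * a ^ 2 := by gcongr
      _ = _ := by ring
  have h3 : (β * ψ * a) ^ 2 ≤ 25 * L ^ 4 * (σ ^ 4 * a ^ 2) := by
    have hb : β ^ 2 ≤ (σ ^ 2) ^ 2 := sq_le_sq' (by linarith [neg_abs_le β])
      ((le_abs_self _).trans hβ)
    calc (β * ψ * a) ^ 2 = β ^ 2 * ψ ^ 2 * a ^ 2 := by ring
      _ ≤ (σ ^ 2) ^ 2 * (5 * L ^ 2) ^ 2 * a ^ 2 := by gcongr
      _ = _ := by ring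
  have hA : 0 ≤ σ ^ 4 * a ^ 2 := by positivity
  have hB : 0 ≤ σ ^ 2 * b ^ 2 := by positivity
  have h4 : ∀ x y z w : ℝ, (x + y + z - w) ^ 2 ≤ 4 * (x ^ 2 + y ^ 2 + z ^ 2 + w ^ 2) := by
    intro x y z w
    nlinarith [sq_nonneg (x - y), sq_nonneg (x - z), sq_nonneg (x + w), sq_nonneg (y - z),
      sq_nonneg (y + w), sq_nonneg (z + w)]
  refine (h4 _ _ _ _).trans ?_
  have p1 : 0 ≤ L ^ 2 := by positivity
  have p2 : 0 ≤ (9 * L ^ 2 + 1) ^ 2 := by positivity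
  have p3 : 0 ≤ L ^ 4 := by positivity
  nlinarith [mul_nonneg p1 hA, mul_nonneg p1 (sq_nonneg c), mul_nonneg p2 hB,
    mul_nonneg p2 (sq_nonneg c), mul_nonneg p3 hB, mul_nonneg p3 (sq_nonneg c)]

theorem cross_term_le (hL : 0 < L) (hm0 : 0 ≤ m) (hm : m ≤ 3 * L) (hσ : 1 ≤ σ)
    (hβ : |β| ≤ σ ^ 2) :
    3 * β * a * (m * c - b) ≤ (9 * L + 3) * (c ^ 2 + σ ^ 2 * b ^ 2 + σ ^ 4 * a ^ 2) := by
  have h1 : 3 * β * a * (m * c - b) ≤ 3 * (σ ^ 2 * |a|) * (3 * L * |c| + |b|) := by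
    calc 3 * β * a * (m * c - b) ≤ |3 * β * a * (m * c - b)| := le_abs_self _
      _ = 3 * (|β| * |a|) * |m * c - b| := by
        rw [abs_mul, abs_mul, abs_mul, abs_of_pos (by norm_num : (0 : ℝ) < 3)]; ring
      _ ≤ 3 * (σ ^ 2 * |a|) * (3 * L * |c| + |b|) := by
        have : |m * c - b| ≤ 3 * L * |c| + |b| := by
          refine (abs_sub _ _).trans ?_
          rw [abs_mul, abs_of_nonneg hm0]
          gcongr
        gcongr
  refine h1.trans ?_
  have ha : (σ ^ 2 * |a|) ^ 2 = σ ^ 4 * a ^ 2 := by rw [mul_pow, sq_abs]; ring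
  have hb : |b| ^ 2 ≤ σ ^ 2 * b ^ 2 := by
    rw [sq_abs]; nlinarith [mul_nonneg (sq_nonneg b) (by nlinarith : (0 : ℝ) ≤ σ ^ 2 - 1)]
  have hc : |c| ^ 2 = c ^ 2 := sq_abs c
  rw [← ha, ← hc]
  set A := σ ^ 2 * |a|
  have q1 := mul_nonneg hL.le (sq_nonneg (A - |c|))
  have q2 := mul_nonneg hL.le (sq_nonneg A)
  have q3 := mul_nonneg hL.le (sq_nonneg |c|)
  have q4 := mul_nonneg hL.le ((sq_nonneg |b|).trans hb)
  nlinarith [sq_nonneg (A - |b|), sq_nonneg A, sq_nonneg |c|, sq_nonneg |b|]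

/-- The constant bounding the lower order terms of the conjugated operator. -/
noncomputable def lowerConst (L : ℝ) : ℝ :=
  8 * (1 + 36 * L ^ 2 + (9 * L ^ 2 + 1) ^ 2 + 25 * L ^ 4) + (9 * L + 3) + 81 * L ^ 3 + 3

/-- The coercivity constant of the principal terms. -/
noncomputable def leadConst (L : ℝ) : ℝ := min 9 (min (18 * L ^ 2) (9 * L ^ 4))

theorem leadConst_pos (hL : 0 < L) : 0 < leadConst L := by
  unfold leadConst; positivity

/-- With `Z = c² + σ² b² + σ⁴ a²`, the bound `m ≥ L` makes the leading terms at least `leadConst L *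
σ * Z`, while all the others are at most `lowerConst L * Z`. The assumption on `σ` lets half of the
former absorb the latter. -/
theorem coercivity (hL : 0 < L) (hm0 : L ≤ m) (hm : m ≤ 3 * L) (hσ : 1 ≤ σ)
    (hσ' : 2 * lowerConst L ≤ leadConst L * σ)
    (hβ : |β| ≤ σ ^ 2) (hψ0 : 0 ≤ ψ) (hψ : ψ ≤ 5 * L ^ 2) :
    leadConst L / 2 * σ * (c ^ 2 + σ ^ 2 * b ^ 2 + σ ^ 4 * a ^ 2) ≤
      9 * σ * c ^ 2 + 18 * σ ^ 3 * m ^ 2 * b ^ 2 + (9 * σ ^ 5 * m ^ 4 - 3 * σ ^ 3) * a ^ 2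
        - 2 * (c + 2 * σ * m * b + (σ ^ 2 * m ^ 2 - σ) * a - β * ψ * a) ^ 2
        - 3 * β * a * (m * c - b) - 3 * β * σ ^ 2 * m ^ 3 * a ^ 2 := by
  have hm1 : 0 ≤ m := hL.le.trans hm0
  have hσ0 : 0 ≤ σ := by linarith
  set Z := c ^ 2 + σ ^ 2 * b ^ 2 + σ ^ 4 * a ^ 2 with hZ
  have hZ0 : 0 ≤ Z := by positivity
  have h1 := lowerOrder_sq_le (a := a) (b := b) (c := c) hm1 hm hσ hβ hψ0 hψ
  have h2 := cross_term_le (a := a) (b := b) (c := c) hL hm1 hm hσ hβ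
  rw [← hZ] at h1 h2
  have hA : σ ^ 4 * a ^ 2 ≤ Z := by
    have : 0 ≤ σ ^ 2 * b ^ 2 := by positivity
    nlinarith [sq_nonneg c]
  have h3 : 3 * β * σ ^ 2 * m ^ 3 * a ^ 2 ≤ 81 * L ^ 3 * Z := by
    calc 3 * β * σ ^ 2 * m ^ 3 * a ^ 2 ≤ 3 * σ ^ 2 * σ ^ 2 * (3 * L) ^ 3 * a ^ 2 := by
          have := (le_abs_self β).trans hβ
          gcongr
      _ = 81 * L ^ 3 * (σ ^ 4 * a ^ 2) := by ring
      _ ≤ _ := by gcongr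
  have h4 : 3 * σ ^ 3 * a ^ 2 ≤ 3 * Z := by
    calc 3 * σ ^ 3 * a ^ 2 ≤ 3 * (σ ^ 4 * a ^ 2) := by
          have : σ ^ 3 ≤ σ ^ 4 := pow_le_pow_right₀ hσ (by norm_num)
          nlinarith [mul_nonneg (sub_nonneg.2 this) (sq_nonneg a)]
      _ ≤ _ := by gcongr
  have h5 : leadConst L * σ * Z ≤
      9 * σ * c ^ 2 + 18 * σ ^ 3 * m ^ 2 * b ^ 2 + 9 * σ ^ 5 * m ^ 4 * a ^ 2 := by
    have l1 : leadConst L ≤ 9 := min_le_left _ _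
    have l2 : leadConst L ≤ 18 * m ^ 2 :=
      ((min_le_right _ _).trans (min_le_left _ _)).trans (by gcongr)
    have l3 : leadConst L ≤ 9 * m ^ 4 :=
      ((min_le_right _ _).trans (min_le_right _ _)).trans (by gcongr)
    calc leadConst L * σ * Z = leadConst L * (σ * c ^ 2) + leadConst L * (σ ^ 3 * b ^ 2)
          + leadConst L * (σ ^ 5 * a ^ 2) := by rw [hZ]; ring
      _ ≤ 9 * (σ * c ^ 2) + 18 * m ^ 2 * (σ ^ 3 * b ^ 2) + 9 * m ^ 4 * (σ ^ 5 * a ^ 2) := by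
        gcongr
      _ = _ := by ring
  have h6 : 2 * lowerConst L * Z ≤ leadConst L * σ * Z := by gcongr
  have h7 : lowerConst L * Z =
      2 * (4 * (1 + 36 * L ^ 2 + (9 * L ^ 2 + 1) ^ 2 + 25 * L ^ 4) * Z) + (9 * L + 3) * Z
        + 81 * L ^ 3 * Z + 3 * Z := by unfold lowerConst; ring
  linarith

/-- The constant comparing the weighted norms of `q` with those of the conjugated function. -/
noncomputable def weightConst (L : ℝ) : ℝ :=
  1 + (2 + 18 * L ^ 2) + (3 + 108 * L ^ 2 + 3 * (9 * L ^ 2 + 1) ^ 2)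

/-- Returns from `u` to `q`: the squares on the left are those of `exp (-σ ψ)` times `q`, `q_x` and
`q_xx`, expressed through `u = a`, `u_x = b`, `u_xx = c`. -/
theorem weighted_le (hm0 : 0 ≤ m) (hm : m ≤ 3 * L) (hσ : 1 ≤ σ) :
    σ ^ 5 * a ^ 2 + σ ^ 3 * (b + σ * m * a) ^ 2
        + σ * (c + 2 * σ * m * b + (σ ^ 2 * m ^ 2 - σ) * a) ^ 2 ≤
      weightConst L * σ * (c ^ 2 + σ ^ 2 * b ^ 2 + σ ^ 4 * a ^ 2) := by
  have hσ0 : 0 ≤ σ := by linarith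
  have hm2 : m ^ 2 ≤ 9 * L ^ 2 := by nlinarith
  have hσ2 : σ ≤ σ ^ 2 := by nlinarith
  set Z := c ^ 2 + σ ^ 2 * b ^ 2 + σ ^ 4 * a ^ 2 with hZ
  have hA0 : 0 ≤ σ ^ 4 * a ^ 2 := by positivity
  have hB0 : 0 ≤ σ ^ 2 * b ^ 2 := by positivity
  have h1 : σ ^ 2 * (b + σ * m * a) ^ 2 ≤ (2 + 18 * L ^ 2) * Z := by
    calc σ ^ 2 * (b + σ * m * a) ^ 2 ≤ σ ^ 2 * (2 * b ^ 2 + 2 * (σ * m * a) ^ 2) := by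
          gcongr; nlinarith [sq_nonneg (b - σ * m * a)]
      _ = 2 * (σ ^ 2 * b ^ 2) + 2 * m ^ 2 * (σ ^ 4 * a ^ 2) := by ring
      _ ≤ 2 * (σ ^ 2 * b ^ 2) + 2 * (9 * L ^ 2) * (σ ^ 4 * a ^ 2) := by gcongr
      _ ≤ _ := by
        rw [hZ]
        nlinarith [mul_nonneg (sq_nonneg L) hB0, mul_nonneg (sq_nonneg L) (sq_nonneg c),
          sq_nonneg c]
  have h2 : (c + 2 * σ * m * b + (σ ^ 2 * m ^ 2 - σ) * a) ^ 2 ≤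
      (3 + 108 * L ^ 2 + 3 * (9 * L ^ 2 + 1) ^ 2) * Z := by
    have h3 : |σ ^ 2 * m ^ 2 - σ| ≤ (9 * L ^ 2 + 1) * σ ^ 2 := by
      rw [abs_le]
      constructor
      · nlinarith [mul_nonneg (sq_nonneg σ) (sq_nonneg m), mul_nonneg (sq_nonneg σ) (sq_nonneg L)]
      · nlinarith [mul_nonneg (sq_nonneg σ) (sub_nonneg.2 hm2), sq_nonneg σ]
    have h4 := sq_le_sq'
      (by linarith [abs_nonneg (σ ^ 2 * m ^ 2 - σ), neg_abs_le (σ ^ 2 * m ^ 2 - σ)])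
      ((le_abs_self _).trans h3)
    calc (c + 2 * σ * m * b + (σ ^ 2 * m ^ 2 - σ) * a) ^ 2 ≤
          3 * c ^ 2 + 3 * (2 * σ * m * b) ^ 2 + 3 * ((σ ^ 2 * m ^ 2 - σ) * a) ^ 2 := by
          generalize 2 * σ * m * b = y
          generalize (σ ^ 2 * m ^ 2 - σ) * a = z
          nlinarith [sq_nonneg (c - y), sq_nonneg (c - z), sq_nonneg (y - z)]
      _ = 3 * c ^ 2 + 12 * m ^ 2 * (σ ^ 2 * b ^ 2) + 3 * (σ ^ 2 * m ^ 2 - σ) ^ 2 * a ^ 2 := by ring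
      _ ≤ 3 * c ^ 2 + 12 * (9 * L ^ 2) * (σ ^ 2 * b ^ 2)
          + 3 * ((9 * L ^ 2 + 1) * σ ^ 2) ^ 2 * a ^ 2 := by gcongr
      _ = 3 * c ^ 2 + 108 * L ^ 2 * (σ ^ 2 * b ^ 2)
          + 3 * (9 * L ^ 2 + 1) ^ 2 * (σ ^ 4 * a ^ 2) := by ring
      _ ≤ _ := by
        rw [hZ]
        have p := sq_nonneg (9 * L ^ 2 + 1)
        nlinarith [mul_nonneg (sq_nonneg L) hA0, mul_nonneg (sq_nonneg L) (sq_nonneg c),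
          sq_nonneg c, mul_nonneg p hB0, mul_nonneg p (sq_nonneg c)]
  have h3 : σ ^ 4 * a ^ 2 ≤ 1 * Z := by rw [hZ]; nlinarith [sq_nonneg c]
  calc _ = σ * (σ ^ 4 * a ^ 2 + σ ^ 2 * (b + σ * m * a) ^ 2
        + (c + 2 * σ * m * b + (σ ^ 2 * m ^ 2 - σ) * a) ^ 2) := by ring
    _ ≤ σ * (1 * Z + (2 + 18 * L ^ 2) * Z
        + (3 + 108 * L ^ 2 + 3 * (9 * L ^ 2 + 1) ^ 2) * Z) := by gcongr
    _ = _ := by unfold weightConst; ring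

end Coercivity

/-! ### The spatial weight and the product of the skew and symmetric parts. -/

/-- The spatial weight, concave, increasing and positive on `[-L, L]`. -/
noncomputable def weight (L x : ℝ) : ℝ := 5 * L ^ 2 - (2 * L - x) ^ 2 / 2

theorem hasDerivAt_weight (L x : ℝ) : HasDerivAt (weight L) (2 * L - x) x := by
  have h := (((hasDerivAt_id x).const_sub (2 * L)).pow 2).div_const 2 |>.const_sub (5 * L ^ 2)
  refine h.congr_deriv ?_
  simp
  ring

theorem contDiff_weight (L : ℝ) : ContDiff ℝ ∞ (weight L) := by
  unfold weight; fun_prop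

/-- On the interval `(2 L - x)² / 2 ≤ 9 L² / 2`; the constant `5 L²` in the weight leaves the margin
`L² / 2`, which also gives the decay of `exp (-σ ψ)` as `σ` grows. -/
theorem weight_ge {L x : ℝ} (hx : x ∈ Icc (-L) L) : L ^ 2 / 2 ≤ weight L x := by
  unfold weight; nlinarith [hx.1, hx.2]

theorem weight_le (L x : ℝ) : weight L x ≤ 5 * L ^ 2 := by
  unfold weight; nlinarith [sq_nonneg (2 * L - x)]

/-- The part of the product of the skew and the symmetric parts of the conjugated operator that is a
derivative in space. -/
theorem HasPrim.conjugate_product {a b σ : ℝ} {p u₀ u₁ u₂ u₃ : ℝ → ℝ}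
    (hp : HasPrim a b p (fun _ => -σ)) (h0 : HasPrim a b u₀ u₁) (h1 : HasPrim a b u₁ u₂)
    (h2 : HasPrim a b u₂ u₃) :
    HasPrim a b
      (fun x => 3 / 2 * (p x * (u₂ x * u₂ x)) + (-(3 * σ)) * (u₁ x * u₂ x)
        + (p x * p x * p x) * (u₀ x * u₂ x) + 4 * ((p x * p x * p x) * (u₁ x * u₁ x))
        + (-(6 * σ)) * ((p x * p x) * (u₀ x * u₁ x)) + (-(3 / 2 * σ ^ 2)) * (p x * (u₀ x * u₀ x))
        + 3 / 2 * ((p x * p x * p x) * (p x * p x) * (u₀ x * u₀ x)))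
      (fun x => (u₃ x + 3 * p x ^ 2 * u₁ x - 3 * σ * p x * u₀ x)
          * (3 * p x * u₂ x - 3 * σ * u₁ x + p x ^ 3 * u₀ x)
        - (9 / 2 * σ * u₂ x ^ 2 + 9 * σ * p x ^ 2 * u₁ x ^ 2
          + (9 / 2 * σ * p x ^ 4 - 3 / 2 * σ ^ 3) * u₀ x ^ 2)) := by
  have hp2 := hp.mul hp
  have hp3 := hp2.mul hp
  have H := ((((((hp.mul (h2.mul h2)).const_mul (3 / 2)).add
    ((h1.mul h2).const_mul (-(3 * σ)))).add (hp3.mul (h0.mul h2))).add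
    ((hp3.mul (h1.mul h1)).const_mul 4)).add
    ((hp2.mul (h0.mul h1)).const_mul (-(6 * σ)))).add
    ((hp.mul (h0.mul h0)).const_mul (-(3 / 2 * σ ^ 2))) |>.add
    (((hp3.mul hp2).mul (h0.mul h0)).const_mul (3 / 2))
  exact H.congr (fun x _ => rfl) (fun x _ => by ring)

/-! ### The estimate in space at a fixed time. -/

section FixedTime

variable {L σ β : ℝ} {w₀ w₁ w₂ w₃ v : ℝ → ℝ}

/-- The weight `exp (-σ ψ)`. -/
noncomputable def ew (L σ x : ℝ) : ℝ := Real.exp (-(σ * weight L x))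

theorem hasPrim_ew (a b L σ : ℝ) :
    HasPrim a b (ew L σ) (fun x => -(σ * (2 * L - x) * ew L σ x)) := by
  refine HasPrim.of_hasDerivAt (fun x _ => ?_) ?_
  · have h := ((hasDerivAt_weight L x).const_mul σ).neg.exp
    refine h.congr_deriv ?_
    simp only [ew, Pi.neg_apply]; ring
  · have : Continuous (weight L) := (contDiff_weight L).continuous
    unfold ew
    fun_prop

theorem hasPrim_slope (a b L σ : ℝ) :
    HasPrim a b (fun x => σ * (2 * L - x)) (fun _ => -σ) := by
  refine HasPrim.of_hasDerivAt (fun x _ => ?_) continuousOn_const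
  have h := ((hasDerivAt_id x).const_sub (2 * L)).const_mul σ
  refine h.congr_deriv ?_
  simp

/-- `exp (-σ ψ) w`. -/
noncomputable def conj₀ (L σ : ℝ) (w₀ : ℝ → ℝ) (x : ℝ) : ℝ := ew L σ x * w₀ x

/-- The first derivative of `exp (-σ ψ) w`. -/
noncomputable def conj₁ (L σ : ℝ) (w₀ w₁ : ℝ → ℝ) (x : ℝ) : ℝ :=
  ew L σ x * (w₁ x - σ * (2 * L - x) * w₀ x)

/-- The second derivative of `exp (-σ ψ) w`. -/
noncomputable def conj₂ (L σ : ℝ) (w₀ w₁ w₂ : ℝ → ℝ) (x : ℝ) : ℝ :=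
  ew L σ x * (w₂ x - 2 * (σ * (2 * L - x)) * w₁ x + ((σ * (2 * L - x)) ^ 2 + σ) * w₀ x)

/-- The third derivative of `exp (-σ ψ) w`. -/
noncomputable def conj₃ (L σ : ℝ) (w₀ w₁ w₂ w₃ : ℝ → ℝ) (x : ℝ) : ℝ :=
  ew L σ x * (w₃ x - 3 * (σ * (2 * L - x)) * w₂ x + 3 * ((σ * (2 * L - x)) ^ 2 + σ) * w₁ x
    - ((σ * (2 * L - x)) ^ 3 + 3 * σ * (σ * (2 * L - x))) * w₀ x)

theorem hasPrim_conj₀ {a b : ℝ} (h0 : HasPrim a b w₀ w₁) :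
    HasPrim a b (conj₀ L σ w₀) (conj₁ L σ w₀ w₁) :=
  ((hasPrim_ew a b L σ).mul h0).congr (fun _ _ => rfl) fun x _ => by simp only [conj₁]; ring

theorem hasPrim_conj₁ {a b : ℝ} (h0 : HasPrim a b w₀ w₁) (h1 : HasPrim a b w₁ w₂) :
    HasPrim a b (conj₁ L σ w₀ w₁) (conj₂ L σ w₀ w₁ w₂) :=
  ((hasPrim_ew a b L σ).mul (h1.add (((hasPrim_slope a b L σ).mul h0).const_mul (-1)))).congr
    (fun x _ => by simp only [conj₁]; ring) fun x _ => by simp only [conj₂]; ring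

theorem hasPrim_conj₂ {a b : ℝ} (h0 : HasPrim a b w₀ w₁) (h1 : HasPrim a b w₁ w₂)
    (h2 : HasPrim a b w₂ w₃) :
    HasPrim a b (conj₂ L σ w₀ w₁ w₂) (conj₃ L σ w₀ w₁ w₂ w₃) := by
  have hp := hasPrim_slope a b L σ
  exact ((hasPrim_ew a b L σ).mul ((h2.add ((hp.mul h1).const_mul (-2))).add
    (((hp.mul hp).add (HasPrim.const σ)).mul h0))).congr
    (fun x _ => by simp only [conj₂]; ring) fun x _ => by simp only [conj₃]; ring

/-- The density, at a fixed time, of the total time derivative in the Carleman estimate; `v` stands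
for the time derivative. -/
noncomputable def timeDensity (L σ β : ℝ) (w₀ w₁ w₂ v : ℝ → ℝ) (x : ℝ) : ℝ :=
  2 * (ew L σ x * v x - β * weight L x * conj₀ L σ w₀ x)
      * (3 * σ * ((2 * L - x) * conj₂ L σ w₀ w₁ w₂ x - conj₁ L σ w₀ w₁ x)
        + σ ^ 3 * ((2 * L - x) ^ 3 * conj₀ L σ w₀ x))
    + 3 * β * (conj₀ L σ w₀ x
      * ((2 * L - x) * conj₂ L σ w₀ w₁ w₂ x - conj₁ L σ w₀ w₁ x))
    + 3 * β * σ ^ 2 * (conj₀ L σ w₀ x * ((2 * L - x) ^ 3 * conj₀ L σ w₀ x))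

/-- `2 A S ≤ (A + S)²`, and `A + S` is the sum of `A + S - Q` and `Q`. -/
theorem two_mul_mul_le (A S Q : ℝ) : 2 * A * S ≤ 2 * (A + S - Q) ^ 2 + 2 * Q ^ 2 := by
  nlinarith [sq_nonneg (A + S - 2 * Q), sq_nonneg A, sq_nonneg S]

/-- Here `a`, `b`, `c`, `d` are `u` and its three space derivatives, `V = exp (-σ ψ) qₜ` and `β =
σₜ`, so that `uₜ = V - β ψ a`. The inequality is `two_mul_mul_le` for the skew part, the symmetric
part and the remainder; everything else is an identity. The terms in `3 β` complete `2 uₜ S u` to a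
total time derivative and are subtracted again on the left. -/
theorem conjugated_operator_estimate (σ β m ψ a b c d V : ℝ) :
    9 * σ * c ^ 2 + 18 * σ ^ 3 * m ^ 2 * b ^ 2 + (9 * σ ^ 5 * m ^ 4 - 3 * σ ^ 3) * a ^ 2
        - 2 * (c + 2 * σ * m * b + (σ ^ 2 * m ^ 2 - σ) * a - β * ψ * a) ^ 2
        - 3 * β * a * (m * c - b) - 3 * β * σ ^ 2 * m ^ 3 * a ^ 2 ≤
      2 * (V - (c + 2 * σ * m * b + (σ ^ 2 * m ^ 2 - σ) * a)
          + (d + 3 * (σ * m) * c + 3 * ((σ * m) ^ 2 - σ) * b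
            + ((σ * m) ^ 3 - 3 * σ * (σ * m)) * a)) ^ 2
        - (2 * (V - β * ψ * a) * (3 * σ * (m * c - b) + σ ^ 3 * (m ^ 3 * a))
            + 3 * β * (a * (m * c - b)) + 3 * β * σ ^ 2 * (a * (m ^ 3 * a)))
        - 2 * ((d + 3 * (σ * m) ^ 2 * b - 3 * σ * (σ * m) * a)
            * (3 * (σ * m) * c - 3 * σ * b + (σ * m) ^ 3 * a)
          - (9 / 2 * σ * c ^ 2 + 9 * σ * (σ * m) ^ 2 * b ^ 2
            + (9 / 2 * σ * (σ * m) ^ 4 - 3 / 2 * σ ^ 3) * a ^ 2)) := by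
  have key := two_mul_mul_le
    ((V - β * ψ * a) + (d + 3 * (σ * m) ^ 2 * b - 3 * σ * (σ * m) * a))
    (3 * (σ * m) * c - 3 * σ * b + (σ * m) ^ 3 * a)
    (c + 2 * σ * m * b + (σ ^ 2 * m ^ 2 - σ) * a - β * ψ * a)
  have hG : (V - β * ψ * a) + (d + 3 * (σ * m) ^ 2 * b - 3 * σ * (σ * m) * a)
      + (3 * (σ * m) * c - 3 * σ * b + (σ * m) ^ 3 * a)
      - (c + 2 * σ * m * b + (σ ^ 2 * m ^ 2 - σ) * a - β * ψ * a) =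
      V - (c + 2 * σ * m * b + (σ ^ 2 * m ^ 2 - σ) * a)
          + (d + 3 * (σ * m) * c + 3 * ((σ * m) ^ 2 - σ) * b
            + ((σ * m) ^ 3 - 3 * σ * (σ * m)) * a) := by ring
  rw [hG] at key
  rw [← sub_nonneg] at key ⊢
  refine key.trans (le_of_eq ?_)
  ring

/-- The last term on the right is minus twice the exact space derivative supplied by
`HasPrim.conjugate_product`, and is kept because it integrates to zero. -/
theorem pointwise_carleman (hL : 0 < L) (hσ : 1 ≤ σ)
    (hσ' : 2 * lowerConst L ≤ leadConst L * σ) (hβ : |β| ≤ σ ^ 2) {x : ℝ} (hx : x ∈ Icc (-L) L) :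
    leadConst L / (2 * weightConst L) *
        ((σ ^ 5 * w₀ x ^ 2 + σ ^ 3 * w₁ x ^ 2 + σ * w₂ x ^ 2) * ew L σ x ^ 2) ≤
      2 * (ew L σ x * (v x - w₂ x + w₃ x)) ^ 2 - timeDensity L σ β w₀ w₁ w₂ v x
        - 2 * ((conj₃ L σ w₀ w₁ w₂ w₃ x + 3 * (σ * (2 * L - x)) ^ 2 * conj₁ L σ w₀ w₁ x
              - 3 * σ * (σ * (2 * L - x)) * conj₀ L σ w₀ x)
            * (3 * (σ * (2 * L - x)) * conj₂ L σ w₀ w₁ w₂ x - 3 * σ * conj₁ L σ w₀ w₁ x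
              + (σ * (2 * L - x)) ^ 3 * conj₀ L σ w₀ x)
          - (9 / 2 * σ * conj₂ L σ w₀ w₁ w₂ x ^ 2
            + 9 * σ * (σ * (2 * L - x)) ^ 2 * conj₁ L σ w₀ w₁ x ^ 2
            + (9 / 2 * σ * (σ * (2 * L - x)) ^ 4 - 3 / 2 * σ ^ 3) * conj₀ L σ w₀ x ^ 2)) := by
  have hψ0 : 0 ≤ weight L x := le_trans (by positivity) (weight_ge hx)
  have hψ := weight_le L x
  have hm0 : L ≤ 2 * L - x := by linarith [hx.2]
  have hm3 : 2 * L - x ≤ 3 * L := by linarith [hx.1]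
  unfold timeDensity
  have e0 : ew L σ x * w₀ x = conj₀ L σ w₀ x := rfl
  have e1 : ew L σ x * w₁ x = conj₁ L σ w₀ w₁ x + σ * (2 * L - x) * conj₀ L σ w₀ x := by
    rw [conj₀, conj₁]; ring
  have e2 : ew L σ x * w₂ x = conj₂ L σ w₀ w₁ w₂ x + 2 * σ * (2 * L - x) * conj₁ L σ w₀ w₁ x
      + (σ ^ 2 * (2 * L - x) ^ 2 - σ) * conj₀ L σ w₀ x := by
    rw [conj₀, conj₁, conj₂]; ring
  have e3 : ew L σ x * w₃ x = conj₃ L σ w₀ w₁ w₂ w₃ x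
      + 3 * (σ * (2 * L - x)) * conj₂ L σ w₀ w₁ w₂ x
      + 3 * ((σ * (2 * L - x)) ^ 2 - σ) * conj₁ L σ w₀ w₁ x
      + ((σ * (2 * L - x)) ^ 3 - 3 * σ * (σ * (2 * L - x))) * conj₀ L σ w₀ x := by
    rw [conj₀, conj₁, conj₂, conj₃]; ring
  have hG : ew L σ x * (v x - w₂ x + w₃ x) =
      ew L σ x * v x - ew L σ x * w₂ x + ew L σ x * w₃ x := by ring
  have hleft : (σ ^ 5 * w₀ x ^ 2 + σ ^ 3 * w₁ x ^ 2 + σ * w₂ x ^ 2) * ew L σ x ^ 2 =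
      σ ^ 5 * (ew L σ x * w₀ x) ^ 2 + σ ^ 3 * (ew L σ x * w₁ x) ^ 2
        + σ * (ew L σ x * w₂ x) ^ 2 := by ring
  rw [hG, hleft, e0, e1, e2, e3]
  generalize conj₀ L σ w₀ x = a
  generalize conj₁ L σ w₀ w₁ x = b
  generalize conj₂ L σ w₀ w₁ w₂ x = c
  generalize conj₃ L σ w₀ w₁ w₂ w₃ x = d
  generalize ew L σ x * v x = V
  have hW : 0 < weightConst L := by unfold weightConst; positivity
  have hl := leadConst_pos hL
  have hwt := weighted_le (L := L) (a := a) (b := b) (c := c) (hL.le.trans hm0) hm3 hσ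
  have hcoer := coercivity (a := a) (b := b) (c := c) hL hm0 hm3 hσ hσ' hβ hψ0 hψ
  refine le_trans ?_ (hcoer.trans (conjugated_operator_estimate σ β (2 * L - x) (weight L x)
    a b c d V))
  refine (mul_le_mul_of_nonneg_left hwt (by positivity)).trans (le_of_eq ?_)
  field_simp

theorem fixedTime_carleman (hL : 0 < L) (hσ : 1 ≤ σ)
    (hσ' : 2 * lowerConst L ≤ leadConst L * σ) (hβ : |β| ≤ σ ^ 2)
    (h0 : HasPrim (-L) L w₀ w₁) (h1 : HasPrim (-L) L w₁ w₂) (h2 : HasPrim (-L) L w₂ w₃)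
    (z0 : w₀ (-L) = 0 ∧ w₀ L = 0) (z1 : w₁ (-L) = 0 ∧ w₁ L = 0) (z2 : w₂ (-L) = 0 ∧ w₂ L = 0)
    (hG : IntegrableOn (fun x => (ew L σ x * (v x - w₂ x + w₃ x)) ^ 2) (Ioc (-L) L))
    (hd : IntegrableOn (timeDensity L σ β w₀ w₁ w₂ v) (Ioc (-L) L)) :
    leadConst L / (2 * weightConst L) * (∫ x in Ioc (-L) L,
        (σ ^ 5 * w₀ x ^ 2 + σ ^ 3 * w₁ x ^ 2 + σ * w₂ x ^ 2) * ew L σ x ^ 2) ≤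
      2 * (∫ x in Ioc (-L) L, (ew L σ x * (v x - w₂ x + w₃ x)) ^ 2)
        - ∫ x in Ioc (-L) L, timeDensity L σ β w₀ w₁ w₂ v x := by
  have hW := (hasPrim_slope (-L) L L σ).conjugate_product (hasPrim_conj₀ (L := L) (σ := σ) h0)
    (hasPrim_conj₁ h0 h1) (hasPrim_conj₂ h0 h1 h2)
  have hW0 := hW.integral_eq (by linarith)
  -- Each term of the primitive contains two factors among `u`, `u_x`, `u_xx`, all zero at both
  -- ends.
  simp only [conj₀, conj₁, conj₂, z0.1, z0.2, z1.1, z1.2, z2.1, z2.2, mul_zero, sub_zero,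
    add_zero] at hW0
  have hi : IntegrableOn (fun x => (σ ^ 5 * w₀ x ^ 2 + σ ^ 3 * w₁ x ^ 2 + σ * w₂ x ^ 2)
      * ew L σ x ^ 2) (Ioc (-L) L) := by
    have c0 := h0.continuousOn
    have c1 := h1.continuousOn
    have c2 := h2.continuousOn
    have ce := (hasPrim_ew (-L) L L σ).continuousOn
    refine (ContinuousOn.integrableOn_compact isCompact_Icc ?_).mono_set Ioc_subset_Icc_self
    fun_prop
  rw [← integral_const_mul, ← integral_const_mul 2, ← integral_sub (hG.const_mul 2) hd]
  have hmono := setIntegral_mono_on (hi.const_mul (leadConst L / (2 * weightConst L)))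
    (((hG.const_mul 2).sub hd).sub (hW.1.const_mul 2)) measurableSet_Ioc
    (fun x hx => pointwise_carleman (v := v) (w₃ := w₃) hL hσ hσ' hβ (Ioc_subset_Icc_self hx))
  refine hmono.trans (le_of_eq ?_)
  have e := integral_sub ((hG.const_mul 2).sub hd) (hW.1.const_mul 2)
  simp only [Pi.sub_apply] at e
  refine e.trans ?_
  rw [integral_const_mul 2]
  simp only [conj₀, conj₁, conj₂]
  rw [hW0]
  simp

end FixedTime

/-! ### Multiplication operators on `L²` as a bounded bilinear map. -/

open scoped BoundedContinuousFunction

theorem memLp_bilin {E F G : Type*} [NormedAddCommGroup E] [NormedSpace ℝ E]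
    [NormedAddCommGroup F] [NormedSpace ℝ F] [NormedAddCommGroup G] [NormedSpace ℝ G]
    (B : E →L[ℝ] F →L[ℝ] G) {α : Type*} {mα : MeasurableSpace α} {μ : Measure α} {p : ℝ≥0∞}
    {f : α → E} {v : α → F} {C : ℝ}
    (hf : AEStronglyMeasurable f μ) (hC : ∀ᵐ t ∂μ, ‖f t‖ ≤ C) (hv : MemLp v p μ) :
    MemLp (fun t => B (f t) (v t)) p μ := by
  have hm : AEStronglyMeasurable (fun t => B (f t) (v t)) μ :=
    B.continuous₂.comp_aestronglyMeasurable (hf.prodMk hv.1)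
  refine MemLp.of_le_mul (c := ‖B‖ * C) hv hm ?_
  filter_upwards [hC] with t ht
  refine (B.le_opNorm₂ _ _).trans ?_
  gcongr

section Multiplication

variable {a b : ℝ}

/-- Multiplication of square integrable functions by bounded continuous functions. -/
noncomputable def mulOp (a b : ℝ) : (ℝ →ᵇ ℝ) →L[ℝ] L2 a b →L[ℝ] L2 a b :=
  ((ContinuousLinearMap.mul ℝ ℝ).holderL (volume.restrict (Ioo a b)) ⊤ 2 2).comp
    (BoundedContinuousFunction.toLp ⊤ (volume.restrict (Ioo a b)) ℝ)

theorem coeFn_mulOp (f : ℝ →ᵇ ℝ) (v : L2 a b) :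
    mulOp a b f v =ᵐ[volume.restrict (Ioo a b)] fun x => f x * v x := by
  have h1 := (ContinuousLinearMap.mul ℝ ℝ).coeFn_holder (r := 2)
    (BoundedContinuousFunction.toLp (E := ℝ) ⊤ (volume.restrict (Ioo a b)) ℝ f) v
  have h2 := BoundedContinuousFunction.coeFn_toLp (p := ⊤) (volume.restrict (Ioo a b)) ℝ f
  filter_upwards [h1, h2] with x e1 e2
  refine e1.trans ?_
  rw [e2]
  rfl

theorem memLp_mulOp {μ : Measure ℝ} {f : ℝ → ℝ →ᵇ ℝ} {v : ℝ → L2 a b} {C : ℝ}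
    (hf : AEStronglyMeasurable f μ) (hC : ∀ᵐ t ∂μ, ‖f t‖ ≤ C) (hv : MemLp v 2 μ) :
    MemLp (fun t => mulOp a b (f t) (v t)) 2 μ :=
  memLp_bilin (mulOp a b) hf hC hv

end Multiplication

/-- Evaluation at a point is a continuous ring homomorphism, so it commutes with the exponential
series. -/
theorem exp_boundedContinuousFunction_apply {α : Type*} [TopologicalSpace α] (f : α →ᵇ ℝ) (x : α) :
    (NormedSpace.exp f) x = Real.exp (f x) := by
  let ev : (α →ᵇ ℝ) →+* ℝ :=
    { toFun := fun g => g x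
      map_one' := rfl
      map_mul' := fun _ _ => rfl
      map_zero' := rfl
      map_add' := fun _ _ => rfl }
  have hc : Continuous ev := (BoundedContinuousFunction.evalCLM ℝ x).continuous
  let _ : NormedAlgebra ℚ (α →ᵇ ℝ) := NormedAlgebra.restrictScalars ℚ ℝ _
  have h := NormedSpace.map_exp ev hc f
  rw [← Real.exp_eq_exp_ℝ] at h
  exact h

/-! ### The weights as bounded continuous functions on the line. -/

section SpatialWeights

/-- A bounded extension of `x ↦ 2 L - x` from `[-L, L]` to the line. -/
noncomputable def slopeB (L : ℝ) : ℝ →ᵇ ℝ :=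
  BoundedContinuousFunction.ofNormedAddCommGroup (fun x => 2 * L - max (-L) (min L x))
    (by fun_prop) (3 * |L|) (fun x => by
      have h1 : |max (-L) (min L x)| ≤ |L| := by
        rw [abs_le]
        exact ⟨(neg_le_neg (le_abs_self L)).trans (le_max_left _ _),
          max_le (neg_le_abs L) ((min_le_left _ _).trans (le_abs_self L))⟩
      rw [Real.norm_eq_abs]
      refine (abs_sub _ _).trans ?_
      rw [abs_mul, abs_two]
      linarith)

/-- A bounded extension of the weight from `[-L, L]` to the line. -/
noncomputable def weightB (L : ℝ) : ℝ →ᵇ ℝ :=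
  BoundedContinuousFunction.const ℝ (5 * L ^ 2) - (1 / 2 : ℝ) • (slopeB L * slopeB L)

/-- The exponential weight `exp (-σ ψ)` as a bounded continuous function. -/
noncomputable def expB (L σ : ℝ) : ℝ →ᵇ ℝ := NormedSpace.exp (σ • (-weightB L))

theorem slopeB_apply_eq (L x : ℝ) : slopeB L x = 2 * L - max (-L) (min L x) := rfl

theorem slopeB_apply {L x : ℝ} (hx : x ∈ Icc (-L) L) : slopeB L x = 2 * L - x := by
  rw [slopeB_apply_eq, min_eq_right hx.2, max_eq_right hx.1]

theorem weightB_apply_eq (L x : ℝ) : weightB L x = 5 * L ^ 2 - slopeB L x ^ 2 / 2 := by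
  simp [weightB]; ring

theorem weightB_apply {L x : ℝ} (hx : x ∈ Icc (-L) L) : weightB L x = weight L x := by
  rw [weightB_apply_eq, slopeB_apply hx, weight]

theorem weightB_ge {L : ℝ} (hL : 0 ≤ L) (x : ℝ) : L ^ 2 / 2 ≤ weightB L x := by
  have h1 : -L ≤ max (-L) (min L x) := le_max_left _ _
  have h2 : max (-L) (min L x) ≤ L := max_le (by linarith) (min_le_left _ _)
  rw [weightB_apply_eq, slopeB_apply_eq]
  nlinarith

theorem expB_apply_eq (L σ x : ℝ) : expB L σ x = Real.exp (-(σ * weightB L x)) := by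
  rw [expB, exp_boundedContinuousFunction_apply]
  simp

theorem expB_apply {L σ x : ℝ} (hx : x ∈ Icc (-L) L) : expB L σ x = ew L σ x := by
  rw [expB_apply_eq, weightB_apply hx, ew]

theorem norm_expB_le {L σ : ℝ} (hL : 0 ≤ L) (hσ : 0 ≤ σ) :
    ‖expB L σ‖ ≤ Real.exp (-(σ * (L ^ 2 / 2))) := by
  rw [BoundedContinuousFunction.norm_le (Real.exp_pos _).le]
  intro x
  rw [expB_apply_eq, Real.norm_eq_abs, Real.abs_exp]
  have := weightB_ge hL x
  gcongr

/-- The exponential is taken in a Banach algebra so that the derivative in `σ` holds in the sup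
norm, hence for the multiplication operators. -/
theorem hasDerivAt_expB (L σ : ℝ) : HasDerivAt (expB L) (-(weightB L * expB L σ)) σ := by
  have h := hasDerivAt_exp_smul_const (𝕂 := ℝ) (-weightB L) σ
  refine h.congr_deriv ?_
  ext x
  simp [expB]
  ring

end SpatialWeights

/-! ### Singular weights in time, written with `ρ = θ^(1/2)`. -/

section TimeWeights

variable {T t : ℝ}

/-- The square root of `1 / (t (T - t))`. -/
noncomputable def rho (T t : ℝ) : ℝ := (√(t * (T - t)))⁻¹

theorem rho_nonneg (T t : ℝ) : 0 ≤ rho T t := by unfold rho; positivity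

theorem mul_sub_pos (ht : t ∈ Ioo 0 T) : 0 < t * (T - t) := mul_pos ht.1 (by linarith [ht.2])

theorem rho_sq (ht : t ∈ Ioo 0 T) : rho T t ^ 2 = 1 / (t * (T - t)) := by
  rw [rho, inv_pow, Real.sq_sqrt (mul_sub_pos ht).le, one_div]

theorem rho_zero (T : ℝ) : rho T 0 = 0 := by simp [rho]

theorem rho_self (T : ℝ) : rho T T = 0 := by simp [rho]

theorem hasDerivAt_rho (ht : t ∈ Ioo 0 T) :
    HasDerivAt (rho T) (-(T - 2 * t) / 2 * rho T t ^ 3) t := by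
  have hg := mul_sub_pos ht
  have h1 : HasDerivAt (fun t => t * (T - t)) (T - 2 * t) t := by
    have := (hasDerivAt_id t).mul ((hasDerivAt_id t).const_sub T)
    refine this.congr_deriv ?_
    simp; ring
  have h2 := (h1.sqrt hg.ne').inv (Real.sqrt_ne_zero'.2 hg)
  refine h2.congr_deriv ?_
  have : √(t * (T - t)) ≠ 0 := Real.sqrt_ne_zero'.2 hg
  rw [rho]
  field_simp

theorem continuousOn_rho (T : ℝ) : ContinuousOn (rho T) (Ioo 0 T) := fun _ ht =>
  (hasDerivAt_rho ht).continuousAt.continuousWithinAt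

/-- From `y ^ k / k! ≤ exp y` with `y = c x²`; the bound `x ^ k ≤ 1 + x ^ (2 k)` turns any power
into an even one. -/
theorem exists_pow_mul_exp_le (k : ℕ) {c : ℝ} (hc : 0 < c) :
    ∃ C, 0 ≤ C ∧ ∀ x : ℝ, 0 ≤ x → x ^ k * Real.exp (-(c * x ^ 2)) ≤ C := by
  refine ⟨1 + k.factorial / c ^ k, by positivity, fun x hx => ?_⟩
  have h1 : x ^ k ≤ 1 + (x ^ 2) ^ k := by
    rw [← pow_mul, mul_comm 2 k, pow_mul]
    nlinarith [sq_nonneg (x ^ k - 1)]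
  have h2 : (x ^ 2) ^ k ≤ k.factorial / c ^ k * Real.exp (c * x ^ 2) := by
    have := Real.pow_div_factorial_le_exp (c * x ^ 2) (by positivity) k
    rw [mul_pow, div_le_iff₀ (by positivity)] at this
    rw [div_mul_eq_mul_div, le_div_iff₀ (by positivity)]
    linarith
  have h3 : Real.exp (-(c * x ^ 2)) ≤ 1 := by
    rw [Real.exp_le_one_iff]; have := mul_nonneg hc.le (sq_nonneg x); linarith
  calc x ^ k * Real.exp (-(c * x ^ 2))
      ≤ (1 + k.factorial / c ^ k * Real.exp (c * x ^ 2)) * Real.exp (-(c * x ^ 2)) := by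
        gcongr; linarith
    _ = Real.exp (-(c * x ^ 2)) +
        k.factorial / c ^ k * (Real.exp (c * x ^ 2) * Real.exp (-(c * x ^ 2))) := by ring
    _ = Real.exp (-(c * x ^ 2)) + k.factorial / c ^ k := by rw [← Real.exp_add]; simp
    _ ≤ _ := by gcongr

variable {L s : ℝ}

theorem exists_norm_weighted_le (hL : 0 < L) (hs : 0 < s) (T : ℝ) (k : ℕ) (w : ℝ →ᵇ ℝ) :
    ∃ C, 0 ≤ C ∧ ∀ t, ‖rho T t ^ k • (w * expB L (s * rho T t ^ 2))‖ ≤ C := by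
  obtain ⟨C, hC0, hC⟩ := exists_pow_mul_exp_le k (c := s * (L ^ 2 / 2)) (by positivity)
  refine ⟨‖w‖ * C, by positivity, fun t => ?_⟩
  have hr := rho_nonneg T t
  rw [norm_smul, norm_pow, Real.norm_of_nonneg hr]
  calc rho T t ^ k * ‖w * expB L (s * rho T t ^ 2)‖
      ≤ rho T t ^ k * (‖w‖ * Real.exp (-(s * rho T t ^ 2 * (L ^ 2 / 2)))) := by
        gcongr
        refine (norm_mul_le _ _).trans ?_
        gcongr
        exact norm_expB_le hL.le (by positivity)
    _ = ‖w‖ * (rho T t ^ k * Real.exp (-(s * (L ^ 2 / 2) * rho T t ^ 2))) := by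
        rw [show s * rho T t ^ 2 * (L ^ 2 / 2) = s * (L ^ 2 / 2) * rho T t ^ 2 by ring]; ring
    _ ≤ ‖w‖ * C := by gcongr; exact hC _ hr

theorem continuousOn_weighted (L s T : ℝ) (k : ℕ) (w : ℝ →ᵇ ℝ) :
    ContinuousOn (fun t => rho T t ^ k • (w * expB L (s * rho T t ^ 2))) (Ioo 0 T) := by
  have h1 := continuousOn_rho T
  have h2 : Continuous (expB L) := continuous_iff_continuousAt.2 fun σ =>
    (hasDerivAt_expB L σ).continuousAt
  exact (h1.pow k).smul (continuousOn_const.mul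
    (h2.comp_continuousOn (continuousOn_const.mul (h1.pow 2))))

/-- The weight `θ^(j/2) exp (-s θ ψ)` with `θ = 1 / (t (T - t))`. -/
noncomputable def timeWeight (L s T : ℝ) (j : ℕ) (t : ℝ) : ℝ →ᵇ ℝ :=
  rho T t ^ j • expB L (s * rho T t ^ 2)

/-- The time derivative of `timeWeight`. -/
noncomputable def timeWeight' (L s T : ℝ) (j : ℕ) (t : ℝ) : ℝ →ᵇ ℝ :=
  (-(T - 2 * t) / 2 * j * rho T t ^ (j + 2)) • expB L (s * rho T t ^ 2)
    + (s * (T - 2 * t) * rho T t ^ (j + 4)) • (weightB L * expB L (s * rho T t ^ 2))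

theorem hasDerivAt_timeWeight {j : ℕ} (hj : 1 ≤ j) (ht : t ∈ Ioo 0 T) :
    HasDerivAt (timeWeight L s T j) (timeWeight' L s T j t) t := by
  have h1 := hasDerivAt_rho ht
  have h2 := (hasDerivAt_expB L (s * rho T t ^ 2)).scomp t ((h1.pow 2).const_mul s)
  have h3 := (h1.pow j).smul h2
  refine h3.congr_deriv ?_
  obtain ⟨i, rfl⟩ : ∃ i, j = i + 1 := ⟨j - 1, by omega⟩
  ext x
  simp [timeWeight']
  ring

theorem exists_norm_timeWeight'_le (hL : 0 < L) (hs : 0 < s) (hT : 0 < T) (j : ℕ) :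
    ∃ C, ∀ t ∈ Ioo 0 T, ‖timeWeight' L s T j t‖ ≤ C := by
  obtain ⟨C₁, h10, h1⟩ := exists_norm_weighted_le hL hs T (j + 2) 1
  obtain ⟨C₂, h20, h2⟩ := exists_norm_weighted_le hL hs T (j + 4) (weightB L)
  refine ⟨T / 2 * j * C₁ + s * T * C₂, fun t ht => ?_⟩
  have hTt : |T - 2 * t| ≤ T := by rw [abs_le]; constructor <;> linarith [ht.1, ht.2]
  have e : timeWeight' L s T j t =
      (-(T - 2 * t) / 2 * j) • (rho T t ^ (j + 2) • (1 * expB L (s * rho T t ^ 2)))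
      + (s * (T - 2 * t)) • (rho T t ^ (j + 4) • (weightB L * expB L (s * rho T t ^ 2))) := by
    rw [timeWeight', one_mul, smul_smul, smul_smul]
  rw [e]
  refine (norm_add_le _ _).trans ?_
  rw [norm_smul (-(T - 2 * t) / 2 * j), norm_smul (s * (T - 2 * t))]
  have n1 : ‖-(T - 2 * t) / 2 * j‖ ≤ T / 2 * j := by
    rw [norm_mul, norm_div, norm_neg, Real.norm_eq_abs]
    simp only [Real.norm_ofNat, Real.norm_natCast]
    gcongr
  have n2 : ‖s * (T - 2 * t)‖ ≤ s * T := by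
    rw [norm_mul, Real.norm_of_nonneg hs.le, Real.norm_eq_abs]
    gcongr
  exact add_le_add (mul_le_mul n1 (h1 t) (norm_nonneg _) (by positivity))
    (mul_le_mul n2 (h2 t) (norm_nonneg _) (by positivity))

theorem continuousOn_timeWeight' (L s T : ℝ) (j : ℕ) :
    ContinuousOn (timeWeight' L s T j) (Ioo 0 T) := by
  have h1 := continuousOn_weighted L s T (j + 2) 1
  have h2 := continuousOn_weighted L s T (j + 4) (weightB L)
  have h3 : ContinuousOn (fun t : ℝ => -(T - 2 * t) / 2 * j) (Ioo 0 T) := by fun_prop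
  have h4 : ContinuousOn (fun t : ℝ => s * (T - 2 * t)) (Ioo 0 T) := by fun_prop
  refine ((h3.smul h1).add (h4.smul h2)).congr fun t _ => ?_
  simp only [timeWeight', Pi.smul_apply', one_mul, smul_smul, Pi.add_apply]

/-- Two more powers of `ρ` are still bounded against the exponential, and `ρ² = 1 / (t (T - t))`; so
the norm is at most `C t (T - t)`, which tends to zero at both ends. -/
theorem continuousOn_timeWeight (hL : 0 < L) (hs : 0 < s) {j : ℕ} (hj : 1 ≤ j) (T : ℝ) :
    ContinuousOn (timeWeight L s T j) (Icc 0 T) := by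
  obtain ⟨C, hC0, hC⟩ := exists_norm_weighted_le hL hs T (j + 2) 1
  have hj0 : j ≠ 0 := by omega
  have hbound : ∀ t ∈ Icc 0 T, ‖timeWeight L s T j t‖ ≤ C * (t * (T - t)) := by
    intro t ht
    -- At the ends `ρ` is the inverse of zero, that is zero. With `j ≥ 1` the weight is then zero
    -- there, which is its limit; with `j = 0` it would be one.
    rcases eq_or_lt_of_le ht.1 with rfl | h1
    · simp [timeWeight, rho_zero, hj0]
    rcases eq_or_lt_of_le ht.2 with rfl | h2
    · simp [timeWeight, rho_self, hj0]
    have hg := mul_sub_pos ⟨h1, h2⟩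
    have hsq := rho_sq ⟨h1, h2⟩
    have e : timeWeight L s T j t =
        (t * (T - t)) • (rho T t ^ (j + 2) • (1 * expB L (s * rho T t ^ 2))) := by
      rw [timeWeight, one_mul, smul_smul, pow_add, hsq]
      congr 1
      field_simp
    rw [e, norm_smul, Real.norm_of_nonneg hg.le, mul_comm]
    gcongr
    exact hC t
  have hz : ∀ t ∈ Icc 0 T, t * (T - t) = 0 →
      ContinuousWithinAt (timeWeight L s T j) (Icc 0 T) t := by
    intro t ht h0
    have hv : timeWeight L s T j t = 0 := by
      have := hbound t ht
      rw [h0, mul_zero] at this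
      exact norm_le_zero_iff.1 this
    rw [ContinuousWithinAt, hv]
    refine squeeze_zero_norm' (a := fun t => C * (t * (T - t)))
      (Filter.eventually_of_mem self_mem_nhdsWithin hbound) ?_
    have hc : Continuous fun t : ℝ => C * (t * (T - t)) := by fun_prop
    have := hc.tendsto t
    rw [h0, mul_zero] at this
    exact this.mono_left nhdsWithin_le_nhds
  intro t ht
  rcases eq_or_lt_of_le ht.1 with h | h1
  · exact hz t ht (by rw [← h]; ring)
  rcases eq_or_lt_of_le ht.2 with h | h2
  · exact hz t ht (by rw [h]; ring)
  exact (hasDerivAt_timeWeight hj ⟨h1, h2⟩).continuousAt.continuousWithinAt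

theorem hasPrim_timeWeight (hL : 0 < L) (hs : 0 < s) (hT : 0 < T) {j : ℕ} (hj : 1 ≤ j) :
    HasPrim 0 T (timeWeight L s T j) (timeWeight' L s T j) := by
  obtain ⟨C, hC⟩ := exists_norm_timeWeight'_le hL hs hT j
  have hi : IntegrableOn (timeWeight' L s T j) (Ioo 0 T) :=
    Integrable.of_bound
      ((continuousOn_timeWeight' L s T j).aestronglyMeasurable measurableSet_Ioo) C
      ((ae_restrict_iff' measurableSet_Ioo).2 (Filter.Eventually.of_forall hC))
  have hi' : IntegrableOn (timeWeight' L s T j) (Ioc 0 T) := by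
    rw [IntegrableOn, ← Measure.restrict_congr_set Ioo_ae_eq_Ioc]
    exact hi
  refine ⟨hi', fun t ht => ?_⟩
  rw [← intervalIntegral.integral_of_le ht.1,
    intervalIntegral.integral_eq_sub_of_hasDerivAt_of_le ht.1
      ((continuousOn_timeWeight hL hs hj T).mono (Icc_subset_Icc_right ht.2))
      (fun x hx => hasDerivAt_timeWeight hj ⟨hx.1, hx.2.trans_le ht.2⟩)
      ((intervalIntegrable_iff_integrableOn_Ioc_of_le ht.1).2
        (hi'.mono_set (Ioc_subset_Ioc_right ht.2)))]
  abel

end TimeWeights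

/-! ### Inner products in `L²` through representatives. -/

section Inner

variable {a b : ℝ}

theorem L2.integrableOn_mul {f g : L2 a b} {F G : ℝ → ℝ}
    (hf : f =ᵐ[volume.restrict (Ioo a b)] F) (hg : g =ᵐ[volume.restrict (Ioo a b)] G) :
    IntegrableOn (fun x => F x * G x) (Ioc a b) := by
  rw [IntegrableOn, ← Measure.restrict_congr_set Ioo_ae_eq_Ioc]
  refine (L2.integrable_inner (𝕜 := ℝ) f g).congr ?_
  filter_upwards [hf, hg] with x h1 h2
  rw [h1, h2]
  exact mul_comm _ _

theorem L2.inner_eq_integral {f g : L2 a b} {F G : ℝ → ℝ}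
    (hf : f =ᵐ[volume.restrict (Ioo a b)] F) (hg : g =ᵐ[volume.restrict (Ioo a b)] G) :
    (inner ℝ f g : ℝ) = ∫ x in Ioc a b, F x * G x := by
  rw [L2.inner_def, integral_Ioc_eq_integral_Ioo]
  refine integral_congr_ae ?_
  filter_upwards [hf, hg] with x h1 h2
  rw [h1, h2]
  exact mul_comm _ _

theorem L2.ae_add {f g : L2 a b} {F G : ℝ → ℝ}
    (hf : f =ᵐ[volume.restrict (Ioo a b)] F) (hg : g =ᵐ[volume.restrict (Ioo a b)] G) :
    (f + g : L2 a b) =ᵐ[volume.restrict (Ioo a b)] fun x => F x + G x := by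
  filter_upwards [Lp.coeFn_add f g, hf, hg] with x h h1 h2
  rw [h, Pi.add_apply, h1, h2]

theorem L2.ae_sub {f g : L2 a b} {F G : ℝ → ℝ}
    (hf : f =ᵐ[volume.restrict (Ioo a b)] F) (hg : g =ᵐ[volume.restrict (Ioo a b)] G) :
    (f - g : L2 a b) =ᵐ[volume.restrict (Ioo a b)] fun x => F x - G x := by
  filter_upwards [Lp.coeFn_sub f g, hf, hg] with x h h1 h2
  rw [h, Pi.sub_apply, h1, h2]

theorem L2.ae_smul (c : ℝ) {f : L2 a b} {F : ℝ → ℝ}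
    (hf : f =ᵐ[volume.restrict (Ioo a b)] F) :
    (c • f : L2 a b) =ᵐ[volume.restrict (Ioo a b)] fun x => c * F x := by
  filter_upwards [Lp.coeFn_smul c f, hf] with x h h1
  rw [h, Pi.smul_apply, h1, smul_eq_mul]

theorem L2.integrableOn (f : L2 a b) : IntegrableOn f (Ioo a b) :=
  (Lp.memLp f).integrable (by norm_num)

end Inner

/-! ### Regular representatives at almost every time. -/

section Regular

variable {L : ℝ}

/-- `(w₀, w₁, w₂)` are the continuous representatives of `f` and of its first two derivatives,
which vanish at the ends of the interval. -/
structure IsRegular (L : ℝ) (f₀ f₁ f₂ f₃ : L2 (-L) L) (w₀ w₁ w₂ : ℝ → ℝ) : Prop where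
  prim₀ : HasPrim (-L) L w₀ w₁
  prim₁ : HasPrim (-L) L w₁ w₂
  prim₂ : HasPrim (-L) L w₂ f₃
  ends₀ : w₀ (-L) = 0 ∧ w₀ L = 0
  ends₁ : w₁ (-L) = 0 ∧ w₁ L = 0
  ends₂ : w₂ (-L) = 0 ∧ w₂ L = 0
  ae₀ : f₀ =ᵐ[volume.restrict (Ioo (-L) L)] w₀
  ae₁ : f₁ =ᵐ[volume.restrict (Ioo (-L) L)] w₁
  ae₂ : f₂ =ᵐ[volume.restrict (Ioo (-L) L)] w₂

theorem VanishesAtEnds.ends_eq_zero {a b : ℝ} (hab : a < b) {f : L2 a b} (h : VanishesAtEnds f)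
    {w : ℝ → ℝ} (hw : ContinuousOn w (Icc a b)) (hf : f =ᵐ[volume.restrict (Ioo a b)] w) :
    w a = 0 ∧ w b = 0 := by
  obtain ⟨g, hg, hfg, h0, h1⟩ := h
  have he : g =ᵐ[volume.restrict (Icc a b)] w := by
    rw [← Measure.restrict_congr_set Ioo_ae_eq_Icc]
    exact hfg.symm.trans hf
  have := Measure.eqOn_Icc_of_ae_eq volume hab.ne he hg hw
  exact ⟨(this (left_mem_Icc.2 hab.le)).symm.trans h0,
    (this (right_mem_Icc.2 hab.le)).symm.trans h1⟩

theorem H.exists_isRegular (hL : 0 < L) (f : H 3 (-L) L) (h0 : VanishesAtEnds (H.D 0 f))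
    (h1 : VanishesAtEnds (H.D 1 f)) (h2 : VanishesAtEnds (H.D 2 f)) :
    ∃ w₀ w₁ w₂, IsRegular L (H.D 0 f) (H.D 1 f) (H.D 2 f) (H.D 3 f) w₀ w₁ w₂ := by
  have hab : -L < L := by linarith
  have d0 : HasWeakDeriv (-L) L (H.D 0 f) (H.D 1 f) := f.2 0
  have d1 : HasWeakDeriv (-L) L (H.D 1 f) (H.D 2 f) := f.2 1
  have d2 : HasWeakDeriv (-L) L (H.D 2 f) (H.D 3 f) := f.2 2
  obtain ⟨w₀, p0, a0⟩ := d0.exists_hasPrim hab (L2.integrableOn _) (L2.integrableOn _)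
  obtain ⟨w₁, p1, a1⟩ := d1.exists_hasPrim hab (L2.integrableOn _) (L2.integrableOn _)
  obtain ⟨w₂, p2, a2⟩ := d2.exists_hasPrim hab (L2.integrableOn _) (L2.integrableOn _)
  refine ⟨w₀, w₁, w₂, ⟨p0.congr_ae ?_, p1.congr_ae ?_, p2,
    h0.ends_eq_zero hab p0.continuousOn a0, h1.ends_eq_zero hab p1.continuousOn a1,
    h2.ends_eq_zero hab p2.continuousOn a2, a0, a1, a2⟩⟩
  · rwa [← Measure.restrict_congr_set Ioo_ae_eq_Ioc]
  · rwa [← Measure.restrict_congr_set Ioo_ae_eq_Ioc]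

/-- Integration by parts of `∂ₓ (m u_x)` against a function from another time, hence with its own
parameter `σ'`. The result is symmetric in the two functions, which is the symmetry the pairing
argument needs. -/
theorem integral_conj_symm (hL : 0 < L) {σ σ' : ℝ} {f₀ f₁ f₂ f₃ f₀' f₁' f₂' f₃' : L2 (-L) L}
    {w₀ w₁ w₂ w₀' w₁' w₂' : ℝ → ℝ}
    (h : IsRegular L f₀ f₁ f₂ f₃ w₀ w₁ w₂) (h' : IsRegular L f₀' f₁' f₂' f₃' w₀' w₁' w₂') :
    ∫ x in Ioc (-L) L, conj₀ L σ' w₀' x *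
        ((2 * L - x) * conj₂ L σ w₀ w₁ w₂ x - conj₁ L σ w₀ w₁ x) =
      -∫ x in Ioc (-L) L, (2 * L - x) * (conj₁ L σ w₀ w₁ x * conj₁ L σ' w₀' w₁' x) := by
  have hm := hasPrim_slope (-L) L L 1
  have hc := hasPrim_conj₀ (L := L) (σ := σ') h'.prim₀
  have hd := hasPrim_conj₁ (L := L) (σ := σ) h.prim₀ h.prim₁
  have H := hc.mul (hm.mul hd)
  have H0 := H.integral_eq (by linarith)
  have i1 := (hm.mul hd).continuousOn_bilin (ContinuousLinearMap.mul ℝ ℝ) hc.1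
  have i2 := hc.continuousOn_bilin (ContinuousLinearMap.mul ℝ ℝ) (hm.mul hd).1
  simp only [ContinuousLinearMap.mul_apply'] at i1 i2
  have e : ∀ x, conj₁ L σ' w₀' w₁' x * (1 * (2 * L - x) * conj₁ L σ w₀ w₁ x)
      = 1 * (2 * L - x) * conj₁ L σ w₀ w₁ x * conj₁ L σ' w₀' w₁' x := fun x => by ring
  simp only [e] at H0
  rw [integral_add i1 i2] at H0
  simp only [conj₀, h'.ends₀.1, h'.ends₀.2, mul_zero, zero_mul, sub_zero] at H0
  rw [add_comm] at H0
  have H1 := eq_neg_of_add_eq_zero_left H0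
  refine Eq.trans ?_ (H1.trans ?_)
  · congr 1; funext x; simp only [conj₀]; ring
  · congr 2; funext x; ring

end Regular

/-! ### Weighted functions with values in `L²`. -/

section WeightedFunctions

variable {L s T : ℝ}

/-- The function `θ^(k/2) w exp (-s θ ψ) v`. -/
noncomputable def weighted (L s T : ℝ) (k : ℕ) (w : ℝ →ᵇ ℝ) (v : ℝ → L2 (-L) L) (t : ℝ) :
    L2 (-L) L :=
  mulOp (-L) L (rho T t ^ k • (w * expB L (s * rho T t ^ 2))) (v t)

theorem memLp_weighted (hL : 0 < L) (hs : 0 < s) (k : ℕ) (w : ℝ →ᵇ ℝ) {v : ℝ → L2 (-L) L}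
    (hv : MemLp v 2 (volume.restrict (Ioo 0 T))) :
    MemLp (weighted L s T k w v) 2 (volume.restrict (Ioo 0 T)) := by
  obtain ⟨C, -, hC⟩ := exists_norm_weighted_le hL hs T k w
  exact memLp_mulOp ((continuousOn_weighted L s T k w).aestronglyMeasurable measurableSet_Ioo)
    (Filter.Eventually.of_forall hC) hv

theorem coeFn_weighted (k : ℕ) (w : ℝ →ᵇ ℝ) (v : ℝ → L2 (-L) L) (t : ℝ) :
    weighted L s T k w v t =ᵐ[volume.restrict (Ioo (-L) L)]
      fun x => rho T t ^ k * (w x * ew L (s * rho T t ^ 2) x) * v t x := by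
  filter_upwards [coeFn_mulOp (rho T t ^ k • (w * expB L (s * rho T t ^ 2))) (v t),
    ae_restrict_mem measurableSet_Ioo] with x h1 h2
  rw [weighted, h1, ← expB_apply (Ioo_subset_Icc_self h2)]
  rfl

/-- The function `θ^(1/2) ∂ₓ ((2 L - x) ∂ₓ u)` for `u = exp (-s θ ψ) q`. -/
noncomputable def fluxDiv (L s T : ℝ) (q₀ q₁ q₂ : ℝ → L2 (-L) L) : ℝ → L2 (-L) L :=
  -- The expansion of `θ^(1/2) (m u_xx - u_x)` in `q`, `q_x`, `q_xx`, with `σ = s ρ²`. The last term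
  -- has two sources: `ψ'' = -1` in `m u_xx`, and the weight differentiated in `-u_x`.
  weighted L s T 1 (slopeB L) q₂ - (2 * s) • weighted L s T 3 (slopeB L ^ 2) q₁
    - weighted L s T 1 1 q₁ + s ^ 2 • weighted L s T 5 (slopeB L ^ 3) q₀
    + (2 * s) • weighted L s T 3 (slopeB L) q₀

theorem memLp_fluxDiv (hL : 0 < L) (hs : 0 < s) {q₀ q₁ q₂ : ℝ → L2 (-L) L}
    (h0 : MemLp q₀ 2 (volume.restrict (Ioo 0 T))) (h1 : MemLp q₁ 2 (volume.restrict (Ioo 0 T)))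
    (h2 : MemLp q₂ 2 (volume.restrict (Ioo 0 T))) :
    MemLp (fluxDiv L s T q₀ q₁ q₂) 2 (volume.restrict (Ioo 0 T)) := by
  have a1 := memLp_weighted hL hs 1 (slopeB L) h2
  have a2 := (memLp_weighted hL hs 3 (slopeB L ^ 2) h1).const_smul (2 * s)
  have a3 := memLp_weighted hL hs 1 1 h1
  have a4 := (memLp_weighted hL hs 5 (slopeB L ^ 3) h0).const_smul (s ^ 2)
  have a5 := (memLp_weighted hL hs 3 (slopeB L) h0).const_smul (2 * s)
  exact (((a1.sub a2).sub a3).add a4).add a5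

theorem coeFn_fluxDiv {q₀ q₁ q₂ : ℝ → L2 (-L) L} {f₃ : L2 (-L) L} {w₀ w₁ w₂ : ℝ → ℝ} {t : ℝ}
    (h : IsRegular L (q₀ t) (q₁ t) (q₂ t) f₃ w₀ w₁ w₂) :
    fluxDiv L s T q₀ q₁ q₂ t =ᵐ[volume.restrict (Ioo (-L) L)]
      fun x => rho T t * ((2 * L - x) * conj₂ L (s * rho T t ^ 2) w₀ w₁ w₂ x
        - conj₁ L (s * rho T t ^ 2) w₀ w₁ x) := by
  have H := L2.ae_add (L2.ae_add (L2.ae_sub (L2.ae_sub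
    (coeFn_weighted (L := L) (s := s) (T := T) 1 (slopeB L) q₂ t)
    (L2.ae_smul (2 * s) (coeFn_weighted (L := L) (s := s) (T := T) 3 (slopeB L ^ 2) q₁ t)))
    (coeFn_weighted (L := L) (s := s) (T := T) 1 1 q₁ t))
    (L2.ae_smul (s ^ 2) (coeFn_weighted (L := L) (s := s) (T := T) 5 (slopeB L ^ 3) q₀ t)))
    (L2.ae_smul (2 * s) (coeFn_weighted (L := L) (s := s) (T := T) 3 (slopeB L) q₀ t))
  filter_upwards [H, h.ae₀, h.ae₁, h.ae₂, ae_restrict_mem measurableSet_Ioo]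
    with x e a0 a1 a2 hx
  refine e.trans ?_
  have hsl := slopeB_apply (Ioo_subset_Icc_self hx)
  rw [a0, a1, a2]
  simp only [BoundedContinuousFunction.coe_pow, Pi.pow_apply, hsl,
    BoundedContinuousFunction.coe_one, Pi.one_apply, conj₂, conj₁]
  ring

end WeightedFunctions

/-! ### The time derivative terms integrate to zero. -/

section TimeIntegration

variable {L s T : ℝ}

/-- The function `θ^(j/2) exp (-s θ ψ) Q`. -/
noncomputable def state (L s T : ℝ) (j : ℕ) (Q : ℝ → L2 (-L) L) (t : ℝ) : L2 (-L) L :=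
  mulOp (-L) L (timeWeight L s T j t) (Q t)

/-- The time derivative of `state`. -/
noncomputable def state' (L s T : ℝ) (j : ℕ) (Q qt : ℝ → L2 (-L) L) (t : ℝ) : L2 (-L) L :=
  mulOp (-L) L (timeWeight' L s T j t) (Q t) + mulOp (-L) L (timeWeight L s T j t) (qt t)

theorem hasPrim_state (hL : 0 < L) (hs : 0 < s) (hT : 0 < T) {j : ℕ} (hj : 1 ≤ j)
    {Q qt : ℝ → L2 (-L) L} (hQ : HasPrim 0 T Q qt) :
    HasPrim 0 T (state L s T j Q) (state' L s T j Q qt) :=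
  (hasPrim_timeWeight hL hs hT hj).bilin (mulOp (-L) L) hQ

theorem memLp_of_hasPrim {E : Type*} [NormedAddCommGroup E] [NormedSpace ℝ E] {f f' : ℝ → E}
    (h : HasPrim 0 T f f') {p : ℝ≥0∞} : MemLp f p (volume.restrict (Ioo 0 T)) := by
  obtain ⟨C, hC⟩ := isCompact_Icc.exists_bound_of_continuousOn h.continuousOn
  refine MemLp.of_bound (h.integrableOn.mono_set Ioo_subset_Ioc_self).1 C ?_
  filter_upwards [ae_restrict_mem measurableSet_Ioo] with x hx
  exact hC x (Ioo_subset_Icc_self hx)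

theorem memLp_state' (hL : 0 < L) (hs : 0 < s) (hT : 0 < T) {j : ℕ} (hj : 1 ≤ j)
    {Q qt : ℝ → L2 (-L) L} (hQ : HasPrim 0 T Q qt)
    (hqt : MemLp qt 2 (volume.restrict (Ioo 0 T))) :
    MemLp (state' L s T j Q qt) 2 (volume.restrict (Ioo 0 T)) := by
  obtain ⟨C, hC⟩ := exists_norm_timeWeight'_le hL hs hT j
  obtain ⟨C', hC'⟩ := isCompact_Icc.exists_bound_of_continuousOn
    (continuousOn_timeWeight hL hs hj T)
  have h1 : MemLp (fun t => mulOp (-L) L (timeWeight' L s T j t) (Q t)) 2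
      (volume.restrict (Ioo 0 T)) :=
    memLp_mulOp ((continuousOn_timeWeight' L s T j).aestronglyMeasurable measurableSet_Ioo)
      ((ae_restrict_iff' measurableSet_Ioo).2 (Filter.Eventually.of_forall hC))
      (memLp_of_hasPrim hQ)
  have h2 : MemLp (fun t => mulOp (-L) L (timeWeight L s T j t) (qt t)) 2
      (volume.restrict (Ioo 0 T)) :=
    memLp_mulOp (((continuousOn_timeWeight hL hs hj T).mono
      Ioo_subset_Icc_self).aestronglyMeasurable measurableSet_Ioo)
      ((ae_restrict_iff' measurableSet_Ioo).2 (Filter.Eventually.of_forall fun t ht =>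
        hC' t (Ioo_subset_Icc_self ht))) hqt
  exact h1.add h2

theorem coeFn_state {j : ℕ} {Q : ℝ → L2 (-L) L} {t : ℝ} {w₀ : ℝ → ℝ}
    (h : Q t =ᵐ[volume.restrict (Ioo (-L) L)] w₀) :
    state L s T j Q t =ᵐ[volume.restrict (Ioo (-L) L)]
      fun x => rho T t ^ j * conj₀ L (s * rho T t ^ 2) w₀ x := by
  filter_upwards [coeFn_mulOp (timeWeight L s T j t) (Q t), h,
    ae_restrict_mem measurableSet_Ioo] with x h1 h2 hx
  rw [state, h1, h2, conj₀, ← expB_apply (Ioo_subset_Icc_self hx), ← mul_assoc]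
  rfl

theorem coeFn_state' {j : ℕ} {Q qt : ℝ → L2 (-L) L} {t : ℝ} {w₀ : ℝ → ℝ}
    (h : Q t =ᵐ[volume.restrict (Ioo (-L) L)] w₀) :
    state' L s T j Q qt t =ᵐ[volume.restrict (Ioo (-L) L)]
      fun x => (-(T - 2 * t) / 2 * j * rho T t ^ (j + 2)
          + s * (T - 2 * t) * rho T t ^ (j + 4) * weight L x) * conj₀ L (s * rho T t ^ 2) w₀ x
        + rho T t ^ j * ew L (s * rho T t ^ 2) x * qt t x := by
  have H := L2.ae_add (coeFn_mulOp (timeWeight' L s T j t) (Q t))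
    (coeFn_mulOp (timeWeight L s T j t) (qt t))
  filter_upwards [H, h, ae_restrict_mem measurableSet_Ioo] with x h1 h2 hx
  have hx' := Ioo_subset_Icc_self hx
  refine h1.trans ?_
  have e1 : timeWeight' L s T j t x = (-(T - 2 * t) / 2 * j * rho T t ^ (j + 2))
      * expB L (s * rho T t ^ 2) x + (s * (T - 2 * t) * rho T t ^ (j + 4))
      * (weightB L x * expB L (s * rho T t ^ 2) x) := rfl
  have e2 : timeWeight L s T j t x = rho T t ^ j * expB L (s * rho T t ^ 2) x := rfl
  rw [e1, e2, h2, conj₀, expB_apply hx', weightB_apply hx']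
  ring

/-- A time at which `q` is regular in space and agrees with its continuous representative `Q`. -/
def IsGoodTime (L : ℝ) (q₀ q₁ q₂ q₃ Q : ℝ → L2 (-L) L) (t : ℝ) : Prop :=
  q₀ t = Q t ∧ ∃ w₀ w₁ w₂, IsRegular L (q₀ t) (q₁ t) (q₂ t) (q₃ t) w₀ w₁ w₂

variable {q₀ q₁ q₂ q₃ Q qt : ℝ → L2 (-L) L}

theorem state_zero {j : ℕ} (hj : 1 ≤ j) : state L s T j Q 0 = 0 := by
  have hj0 : j ≠ 0 := by omega
  have h : timeWeight L s T j 0 = 0 := by simp [timeWeight, rho_zero, hj0]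
  rw [state, h, map_zero, zero_apply]

theorem state_self {j : ℕ} (hj : 1 ≤ j) : state L s T j Q T = 0 := by
  have hj0 : j ≠ 0 := by omega
  have h : timeWeight L s T j T = 0 := by simp [timeWeight, rho_self, hj0]
  rw [state, h, map_zero, zero_apply]

/-- Both sides equal `-ρ(t) ρ(t') ∫ m u_x(t) u_x(t')`. The factor `θ` of the form is split evenly
between the two arguments precisely to make this symmetric. -/
theorem inner_state_fluxDiv_symm (hL : 0 < L) {t t' : ℝ} (ht : IsGoodTime L q₀ q₁ q₂ q₃ Q t)
    (ht' : IsGoodTime L q₀ q₁ q₂ q₃ Q t') :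
    (inner ℝ (state L s T 1 Q t') (fluxDiv L s T q₀ q₁ q₂ t) : ℝ) =
      inner ℝ (state L s T 1 Q t) (fluxDiv L s T q₀ q₁ q₂ t') := by
  obtain ⟨hQ, w₀, w₁, w₂, h⟩ := ht
  obtain ⟨hQ', w₀', w₁', w₂', h'⟩ := ht'
  rw [L2.inner_eq_integral (coeFn_state (hQ' ▸ h'.ae₀)) (coeFn_fluxDiv h),
    L2.inner_eq_integral (coeFn_state (hQ ▸ h.ae₀)) (coeFn_fluxDiv h')]
  have e : ∀ (c d : ℝ) (F G : ℝ → ℝ), ∫ x in Ioc (-L) L, c ^ 1 * F x * (d * G x) =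
      c * d * ∫ x in Ioc (-L) L, F x * G x := fun c d F G => by
    rw [← integral_const_mul]; congr 1; funext x; ring
  rw [e, e, integral_conj_symm hL h h', integral_conj_symm hL h' h]
  simp only [mul_comm (conj₁ L (s * rho T t' ^ 2) w₀' w₁' _)]
  ring

theorem inner_state_weighted_symm {t t' : ℝ} (ht : IsGoodTime L q₀ q₁ q₂ q₃ Q t)
    (ht' : IsGoodTime L q₀ q₁ q₂ q₃ Q t') (w : ℝ →ᵇ ℝ) :
    (inner ℝ (state L s T 3 Q t') (weighted L s T 3 w q₀ t) : ℝ) =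
      inner ℝ (state L s T 3 Q t) (weighted L s T 3 w q₀ t') := by
  rw [L2.inner_eq_integral (coeFn_state (Filter.EventuallyEq.refl _ (Q t')))
      (coeFn_weighted 3 w q₀ t),
    L2.inner_eq_integral (coeFn_state (Filter.EventuallyEq.refl _ (Q t)))
      (coeFn_weighted 3 w q₀ t'), ht.1, ht'.1]
  congr 1; funext x
  simp only [conj₀]
  ring

theorem integral_inner_fluxDiv (hL : 0 < L) (hs : 0 < s) (hT : 0 < T)
    (h0 : MemLp q₀ 2 (volume.restrict (Ioo 0 T))) (h1 : MemLp q₁ 2 (volume.restrict (Ioo 0 T)))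
    (h2 : MemLp q₂ 2 (volume.restrict (Ioo 0 T))) (hqt : MemLp qt 2 (volume.restrict (Ioo 0 T)))
    (hQ : HasPrim 0 T Q qt)
    (hgood : ∀ᵐ t ∂(volume.restrict (Ioo 0 T)), IsGoodTime L q₀ q₁ q₂ q₃ Q t) :
    ∫ t in Ioo 0 T, (inner ℝ (state' L s T 1 Q qt t) (fluxDiv L s T q₀ q₁ q₂ t) : ℝ) = 0 :=
  (hasPrim_state hL hs hT le_rfl hQ).integral_inner_eq_zero hT.le (state_zero le_rfl)
    (state_self le_rfl) (memLp_state' hL hs hT le_rfl hQ hqt) (memLp_fluxDiv hL hs h0 h1 h2)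
    (S := {t | IsGoodTime L q₀ q₁ q₂ q₃ Q t}) hgood
    (fun _ ht _ ht' => inner_state_fluxDiv_symm hL ht ht')

theorem integral_inner_weighted (hL : 0 < L) (hs : 0 < s) (hT : 0 < T)
    (h0 : MemLp q₀ 2 (volume.restrict (Ioo 0 T))) (hqt : MemLp qt 2 (volume.restrict (Ioo 0 T)))
    (hQ : HasPrim 0 T Q qt)
    (hgood : ∀ᵐ t ∂(volume.restrict (Ioo 0 T)), IsGoodTime L q₀ q₁ q₂ q₃ Q t) (w : ℝ →ᵇ ℝ) :
    ∫ t in Ioo 0 T, (inner ℝ (state' L s T 3 Q qt t) (weighted L s T 3 w q₀ t) : ℝ) = 0 := by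
  have hj : 1 ≤ 3 := by norm_num
  exact (hasPrim_state hL hs hT hj hQ).integral_inner_eq_zero hT.le (state_zero hj)
    (state_self hj) (memLp_state' hL hs hT hj hQ hqt) (memLp_weighted hL hs 3 w h0)
    (S := {t | IsGoodTime L q₀ q₁ q₂ q₃ Q t}) hgood
    (fun _ ht _ ht' => inner_state_weighted_symm ht ht' w)

end TimeIntegration

/-! ### Transfer of the fixed-time estimate to functions with values in `L²`. -/

section FixedTime

variable {L s T : ℝ} {q₀ q₁ q₂ q₃ Q qt : ℝ → L2 (-L) L}

/-- The total time derivative in the Carleman estimate. -/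
noncomputable def timeTerm (L s T : ℝ) (q₀ q₁ q₂ Q qt : ℝ → L2 (-L) L) (t : ℝ) : ℝ :=
  6 * s * inner ℝ (state' L s T 1 Q qt t) (fluxDiv L s T q₀ q₁ q₂ t)
    + 2 * s ^ 3 * inner ℝ (state' L s T 3 Q qt t) (weighted L s T 3 (slopeB L ^ 3) q₀ t)

/-- Differentiating the weights `θ^(1/2)` and `θ^(3/2)` inside `state'` produces exactly the terms
`3 β` and `3 β σ²` of `timeDensity`, since `β = s θ' = -s (T - 2 t) θ²`. -/
theorem timeTerm_eq {t : ℝ} {w₀ w₁ w₂ : ℝ → ℝ} (hq : q₀ t = Q t)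
    (h : IsRegular L (q₀ t) (q₁ t) (q₂ t) (q₃ t) w₀ w₁ w₂) :
    IntegrableOn (timeDensity L (s * rho T t ^ 2) (-(s * (T - 2 * t) * rho T t ^ 4)) w₀ w₁ w₂
      (qt t)) (Ioc (-L) L) ∧
    timeTerm L s T q₀ q₁ q₂ Q qt t = ∫ x in Ioc (-L) L, timeDensity L (s * rho T t ^ 2)
      (-(s * (T - 2 * t) * rho T t ^ 4)) w₀ w₁ w₂ (qt t) x := by
  have a1 := coeFn_state' (s := s) (T := T) (j := 1) (qt := qt) (hq ▸ h.ae₀)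
  have a3 := coeFn_state' (s := s) (T := T) (j := 3) (qt := qt) (hq ▸ h.ae₀)
  have b1 := coeFn_fluxDiv (s := s) (T := T) h
  have b3 : weighted L s T 3 (slopeB L ^ 3) q₀ t =ᵐ[volume.restrict (Ioo (-L) L)]
      fun x => rho T t ^ 3 * ((2 * L - x) ^ 3 * conj₀ L (s * rho T t ^ 2) w₀ x) := by
    filter_upwards [coeFn_weighted (s := s) (T := T) 3 (slopeB L ^ 3) q₀ t, h.ae₀,
      ae_restrict_mem measurableSet_Ioo] with x e1 e2 hx
    rw [e1, e2, conj₀, BoundedContinuousFunction.coe_pow, Pi.pow_apply,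
      slopeB_apply (Ioo_subset_Icc_self hx)]
    ring
  have i1 := (L2.integrableOn_mul a1 b1).const_mul (6 * s)
  have i3 := (L2.integrableOn_mul a3 b3).const_mul (2 * s ^ 3)
  have e : timeDensity L (s * rho T t ^ 2) (-(s * (T - 2 * t) * rho T t ^ 4)) w₀ w₁ w₂ (qt t) =
      fun x => 6 * s * (((-(T - 2 * t) / 2 * (1 : ℕ) * rho T t ^ (1 + 2)
          + s * (T - 2 * t) * rho T t ^ (1 + 4) * weight L x) * conj₀ L (s * rho T t ^ 2) w₀ x
        + rho T t ^ 1 * ew L (s * rho T t ^ 2) x * qt t x)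
        * (rho T t * ((2 * L - x) * conj₂ L (s * rho T t ^ 2) w₀ w₁ w₂ x
        - conj₁ L (s * rho T t ^ 2) w₀ w₁ x))) +
        2 * s ^ 3 * (((-(T - 2 * t) / 2 * (3 : ℕ) * rho T t ^ (3 + 2)
          + s * (T - 2 * t) * rho T t ^ (3 + 4) * weight L x) * conj₀ L (s * rho T t ^ 2) w₀ x
        + rho T t ^ 3 * ew L (s * rho T t ^ 2) x * qt t x)
        * (rho T t ^ 3 * ((2 * L - x) ^ 3 * conj₀ L (s * rho T t ^ 2) w₀ x))) := by
    funext x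
    rw [timeDensity]
    push_cast
    ring
  refine ⟨by rw [e]; exact i1.add i3, ?_⟩
  rw [timeTerm, L2.inner_eq_integral a1 b1, L2.inner_eq_integral a3 b3, e,
    ← integral_const_mul, ← integral_const_mul, ← integral_add i1 i3]

theorem norm_sq_weighted_eq {t : ℝ} {w₀ w₁ w₂ : ℝ → ℝ}
    (h : IsRegular L (q₀ t) (q₁ t) (q₂ t) (q₃ t) w₀ w₁ w₂) :
    IntegrableOn (fun x => (ew L (s * rho T t ^ 2) x * (qt t x - w₂ x + q₃ t x)) ^ 2)
      (Ioc (-L) L) ∧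
    ‖weighted L s T 0 1 (qt - q₂ + q₃) t‖ ^ 2 =
      ∫ x in Ioc (-L) L, (ew L (s * rho T t ^ 2) x * (qt t x - w₂ x + q₃ t x)) ^ 2 := by
  have hG : weighted L s T 0 1 (qt - q₂ + q₃) t =ᵐ[volume.restrict (Ioo (-L) L)]
      fun x => ew L (s * rho T t ^ 2) x * (qt t x - w₂ x + q₃ t x) := by
    have H := L2.ae_add (L2.ae_sub (Filter.EventuallyEq.refl _ (qt t)) h.ae₂)
      (Filter.EventuallyEq.refl _ (q₃ t))
    filter_upwards [coeFn_weighted (s := s) (T := T) 0 1 (qt - q₂ + q₃) t, H] with x e1 e2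
    have e3 : (qt - q₂ + q₃) t x = qt t x - w₂ x + q₃ t x := e2
    rw [e1, e3]
    simp
  refine ⟨(L2.integrableOn_mul hG hG).congr_fun (fun x _ => (sq _).symm) measurableSet_Ioc, ?_⟩
  rw [← real_inner_self_eq_norm_sq, L2.inner_eq_integral hG hG]
  congr 1
  funext x
  exact (sq _).symm

/-- The weighted integral on the left of the Carleman estimate, at a fixed time. -/
theorem lintegral_left_eq (hs : 0 < s) {t : ℝ} (ht : t ∈ Ioo 0 T) {w₀ w₁ w₂ : ℝ → ℝ}
    (h : IsRegular L (q₀ t) (q₁ t) (q₂ t) (q₃ t) w₀ w₁ w₂) :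
    ∫⁻ x in Ioo (-L) L, ENNReal.ofReal
        ((s ^ 5 / (t ^ 5 * (T - t) ^ 5) * |q₀ t x| ^ 2
          + s ^ 3 / (t ^ 3 * (T - t) ^ 3) * |q₁ t x| ^ 2
          + s / (t * (T - t)) * |q₂ t x| ^ 2)
          * Real.exp (-(2 * s * weight L x / (t * (T - t))))) =
      ENNReal.ofReal (∫ x in Ioc (-L) L, ((s * rho T t ^ 2) ^ 5 * w₀ x ^ 2
        + (s * rho T t ^ 2) ^ 3 * w₁ x ^ 2 + (s * rho T t ^ 2) * w₂ x ^ 2)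
        * ew L (s * rho T t ^ 2) x ^ 2) := by
  have hσ : 0 ≤ s * rho T t ^ 2 := by positivity
  have hi : IntegrableOn (fun x => ((s * rho T t ^ 2) ^ 5 * w₀ x ^ 2
        + (s * rho T t ^ 2) ^ 3 * w₁ x ^ 2 + (s * rho T t ^ 2) * w₂ x ^ 2)
        * ew L (s * rho T t ^ 2) x ^ 2) (Ioo (-L) L) := by
    have c0 := h.prim₀.continuousOn
    have c1 := h.prim₁.continuousOn
    have c2 := h.prim₂.continuousOn
    have ce := (hasPrim_ew (-L) L L (s * rho T t ^ 2)).continuousOn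
    refine (ContinuousOn.integrableOn_compact isCompact_Icc ?_).mono_set Ioo_subset_Icc_self
    fun_prop
  rw [integral_Ioc_eq_integral_Ioo, ofReal_integral_eq_lintegral_ofReal hi
    (Filter.Eventually.of_forall fun x => by positivity)]
  refine lintegral_congr_ae ?_
  filter_upwards [h.ae₀, h.ae₁, h.ae₂] with x a0 a1 a2
  have hg := (mul_sub_pos ht).ne'
  have hsq := rho_sq ht
  have e5 : s ^ 5 / (t ^ 5 * (T - t) ^ 5) = (s * rho T t ^ 2) ^ 5 := by
    rw [hsq, ← mul_pow, ← div_pow, mul_one_div]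
  have e3 : s ^ 3 / (t ^ 3 * (T - t) ^ 3) = (s * rho T t ^ 2) ^ 3 := by
    rw [hsq, ← mul_pow, ← div_pow, mul_one_div]
  have e1 : s / (t * (T - t)) = s * rho T t ^ 2 := by rw [hsq, mul_one_div]
  have ee : Real.exp (-(2 * s * weight L x / (t * (T - t)))) = ew L (s * rho T t ^ 2) x ^ 2 := by
    rw [ew, ← Real.exp_nat_mul, ← e1]
    congr 1
    push_cast
    ring
  rw [a0, a1, a2, sq_abs, sq_abs, sq_abs, e5, e3, e1, ee]

theorem lintegral_right_eq {t : ℝ} (ht : t ∈ Ioo 0 T) {w₀ w₁ w₂ : ℝ → ℝ}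
    (h : IsRegular L (q₀ t) (q₁ t) (q₂ t) (q₃ t) w₀ w₁ w₂) :
    ∫⁻ x in Ioo (-L) L, ENNReal.ofReal (|qt t x - q₂ t x + q₃ t x| ^ 2
        * Real.exp (-(2 * s * weight L x / (t * (T - t))))) =
      ENNReal.ofReal (‖weighted L s T 0 1 (qt - q₂ + q₃) t‖ ^ 2) := by
  obtain ⟨hi, he⟩ := norm_sq_weighted_eq (s := s) (T := T) (qt := qt) h
  rw [he, integral_Ioc_eq_integral_Ioo, ofReal_integral_eq_lintegral_ofReal
    (hi.mono_set Ioo_subset_Ioc_self) (Filter.Eventually.of_forall fun x => by positivity)]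
  refine lintegral_congr_ae ?_
  filter_upwards [h.ae₂] with x a2
  have e1 : s / (t * (T - t)) = s * rho T t ^ 2 := by rw [rho_sq ht, mul_one_div]
  have ee : Real.exp (-(2 * s * weight L x / (t * (T - t)))) = ew L (s * rho T t ^ 2) x ^ 2 := by
    rw [ew, ← Real.exp_nat_mul, ← e1]
    congr 1
    push_cast
    ring
  rw [a2, sq_abs, ee, mul_pow, mul_comm]

/-- `t (T - t)` is largest at the midpoint, with value `T² / 4`. -/
theorem four_div_sq_le_rho_sq {t : ℝ} (ht : t ∈ Ioo 0 T) : 4 / T ^ 2 ≤ rho T t ^ 2 := by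
  have hT : 0 < T := ht.1.trans ht.2
  rw [rho_sq ht, div_le_div_iff₀ (by positivity) (mul_sub_pos ht)]
  nlinarith [sq_nonneg (T - 2 * t)]

/-- The lower bound on the parameter in the Carleman estimate. -/
noncomputable def threshold (L T : ℝ) : ℝ :=
  -- Since `σ ≥ 4 s / T²`, the three bounds give in turn `|β| ≤ σ²`, `σ ≥ 1` and the absorption
  -- condition of `coercivity`.
  max T (max (T ^ 2 / 4) (T ^ 2 / 4 * (2 * lowerConst L / leadConst L)))

theorem goodTime_carleman (hL : 0 < L) (hT : 0 < T) (hs : threshold L T ≤ s) {t : ℝ}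
    (ht : t ∈ Ioo 0 T) {w₀ w₁ w₂ : ℝ → ℝ} (hq : q₀ t = Q t)
    (h : IsRegular L (q₀ t) (q₁ t) (q₂ t) (q₃ t) w₀ w₁ w₂) :
    leadConst L / (2 * weightConst L) * (∫ x in Ioc (-L) L, ((s * rho T t ^ 2) ^ 5 * w₀ x ^ 2
        + (s * rho T t ^ 2) ^ 3 * w₁ x ^ 2 + (s * rho T t ^ 2) * w₂ x ^ 2)
        * ew L (s * rho T t ^ 2) x ^ 2) ≤
      2 * ‖weighted L s T 0 1 (qt - q₂ + q₃) t‖ ^ 2 - timeTerm L s T q₀ q₁ q₂ Q qt t := by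
  obtain ⟨i1, e1⟩ := timeTerm_eq (s := s) (T := T) (qt := qt) hq h
  obtain ⟨i2, e2⟩ := norm_sq_weighted_eq (s := s) (T := T) (qt := qt) h
  rw [e1, e2]
  have hl := leadConst_pos hL
  have hsT : T ≤ s := (le_max_left _ _).trans hs
  have hs0 : 0 < s := hT.trans_le hsT
  have hs1 : T ^ 2 / 4 ≤ s := ((le_max_left _ _).trans (le_max_right _ _)).trans hs
  have hs2 : T ^ 2 / 4 * (2 * lowerConst L / leadConst L) ≤ s :=
    ((le_max_right _ _).trans (le_max_right _ _)).trans hs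
  have hr := four_div_sq_le_rho_sq ht
  have hσ0 : s * (4 / T ^ 2) ≤ s * rho T t ^ 2 := by gcongr
  have hσ1 : 1 ≤ s * rho T t ^ 2 := by
    refine le_trans ?_ hσ0
    calc (1 : ℝ) = T ^ 2 / 4 * (4 / T ^ 2) := by field_simp
      _ ≤ _ := by gcongr
  have hσ2 : 2 * lowerConst L ≤ leadConst L * (s * rho T t ^ 2) := by
    have h3 : 2 * lowerConst L / leadConst L ≤ s * rho T t ^ 2 := by
      refine le_trans ?_ hσ0
      calc 2 * lowerConst L / leadConst L =
          T ^ 2 / 4 * (2 * lowerConst L / leadConst L) * (4 / T ^ 2) := by field_simp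
        _ ≤ _ := by gcongr
    rw [div_le_iff₀ hl] at h3
    linarith
  have hβ : |(-(s * (T - 2 * t) * rho T t ^ 4))| ≤ (s * rho T t ^ 2) ^ 2 := by
    have hTt : |T - 2 * t| ≤ T := by rw [abs_le]; constructor <;> linarith [ht.1, ht.2]
    have h4 : 0 ≤ rho T t ^ 4 := by positivity
    rw [abs_neg, abs_mul, abs_mul, abs_of_pos hs0, abs_of_nonneg h4]
    calc s * |T - 2 * t| * rho T t ^ 4 ≤ s * s * rho T t ^ 4 := by
          gcongr; exact hTt.trans hsT
      _ = _ := by ring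
  exact fixedTime_carleman hL hσ1 hσ2 hβ h.prim₀ h.prim₁ h.prim₂ h.ends₀ h.ends₁ h.ends₂ i2 i1

end FixedTime

/-! ### Integration in time. -/

section Carleman

variable {L s T : ℝ} {q₀ q₁ q₂ q₃ Q qt : ℝ → L2 (-L) L}

/-- At a good time the left density is at most `K (2 Γ - D)`, where `Γ` is the right density and `D`
the total time derivative. As `∫ D = 0`, integration leaves the constant `2 K = 4 weightConst L /
leadConst L`. -/
theorem carleman_of_ae_isGoodTime (hL : 0 < L) (hT : 0 < T) (hs : threshold L T ≤ s)
    (h0 : MemLp q₀ 2 (volume.restrict (Ioo 0 T))) (h1 : MemLp q₁ 2 (volume.restrict (Ioo 0 T)))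
    (h2 : MemLp q₂ 2 (volume.restrict (Ioo 0 T))) (h3 : MemLp q₃ 2 (volume.restrict (Ioo 0 T)))
    (hqt : MemLp qt 2 (volume.restrict (Ioo 0 T))) (hQ : HasPrim 0 T Q qt)
    (hgood : ∀ᵐ t ∂(volume.restrict (Ioo 0 T)), IsGoodTime L q₀ q₁ q₂ q₃ Q t) :
    ∫⁻ t in Ioo 0 T, ∫⁻ x in Ioo (-L) L, ENNReal.ofReal
        ((s ^ 5 / (t ^ 5 * (T - t) ^ 5) * |q₀ t x| ^ 2
          + s ^ 3 / (t ^ 3 * (T - t) ^ 3) * |q₁ t x| ^ 2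
          + s / (t * (T - t)) * |q₂ t x| ^ 2)
          * Real.exp (-(2 * s * weight L x / (t * (T - t))))) ≤
      ENNReal.ofReal (4 * weightConst L / leadConst L) *
        ∫⁻ t in Ioo 0 T, ∫⁻ x in Ioo (-L) L, ENNReal.ofReal (|qt t x - q₂ t x + q₃ t x| ^ 2
          * Real.exp (-(2 * s * weight L x / (t * (T - t))))) := by
  have hs0 : 0 < s := hT.trans_le ((le_max_left _ _).trans hs)
  have hl := leadConst_pos hL
  have hW : 0 < weightConst L := by unfold weightConst; positivity
  set K := 2 * weightConst L / leadConst L with hK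
  have hK0 : 0 < K := by positivity
  set Γ : ℝ → ℝ := fun t => ‖weighted L s T 0 1 (qt - q₂ + q₃) t‖ ^ 2 with hΓ
  set D : ℝ → ℝ := timeTerm L s T q₀ q₁ q₂ Q qt with hD
  have hΓi : IntegrableOn Γ (Ioo 0 T) :=
    (memLp_weighted hL hs0 0 1 ((hqt.sub h2).add h3)).integrable_norm_pow (by norm_num)
  have hj : 1 ≤ 3 := by norm_num
  have i₁ := (integrable_inner_of_memLp (memLp_state' hL hs0 hT le_rfl hQ hqt)
    (memLp_fluxDiv hL hs0 h0 h1 h2)).const_mul (6 * s)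
  have i₂ := (integrable_inner_of_memLp (memLp_state' hL hs0 hT hj hQ hqt)
    (memLp_weighted hL hs0 3 (slopeB L ^ 3) h0)).const_mul (2 * s ^ 3)
  have hDi : IntegrableOn D (Ioo 0 T) := i₁.add i₂
  have hD0 : ∫ t in Ioo 0 T, D t = 0 := by
    refine (integral_add i₁ i₂).trans ?_
    rw [integral_const_mul, integral_const_mul,
      integral_inner_fluxDiv hL hs0 hT h0 h1 h2 hqt hQ hgood,
      integral_inner_weighted hL hs0 hT h0 hqt hQ hgood]
    simp
  have hi : IntegrableOn (fun t => K * (2 * Γ t - D t)) (Ioo 0 T) :=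
    ((hΓi.const_mul 2).sub hDi).const_mul K
  have hpt : ∀ᵐ t ∂(volume.restrict (Ioo 0 T)),
      0 ≤ K * (2 * Γ t - D t) ∧
      ∫⁻ x in Ioo (-L) L, ENNReal.ofReal
        ((s ^ 5 / (t ^ 5 * (T - t) ^ 5) * |q₀ t x| ^ 2
          + s ^ 3 / (t ^ 3 * (T - t) ^ 3) * |q₁ t x| ^ 2
          + s / (t * (T - t)) * |q₂ t x| ^ 2)
          * Real.exp (-(2 * s * weight L x / (t * (T - t))))) ≤
        ENNReal.ofReal (K * (2 * Γ t - D t)) ∧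
      ∫⁻ x in Ioo (-L) L, ENNReal.ofReal (|qt t x - q₂ t x + q₃ t x| ^ 2
          * Real.exp (-(2 * s * weight L x / (t * (T - t))))) = ENNReal.ofReal (Γ t) := by
    filter_upwards [hgood, ae_restrict_mem measurableSet_Ioo] with t hg ht
    obtain ⟨hq, w₀, w₁, w₂, h⟩ := hg
    have hc := goodTime_carleman (qt := qt) hL hT hs ht hq h
    set A := ∫ x in Ioc (-L) L, ((s * rho T t ^ 2) ^ 5 * w₀ x ^ 2
        + (s * rho T t ^ 2) ^ 3 * w₁ x ^ 2 + (s * rho T t ^ 2) * w₂ x ^ 2)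
        * ew L (s * rho T t ^ 2) x ^ 2 with hA
    have hA0 : 0 ≤ A := integral_nonneg fun x => by positivity
    have hAle : A ≤ K * (2 * Γ t - D t) := by
      have e : K * (leadConst L / (2 * weightConst L) * A) = A := by rw [hK]; field_simp
      rw [← e]
      exact mul_le_mul_of_nonneg_left hc hK0.le
    refine ⟨hA0.trans hAle, ?_, lintegral_right_eq ht h⟩
    rw [lintegral_left_eq hs0 ht h]
    exact ENNReal.ofReal_le_ofReal hAle
  have hright : ∫⁻ t in Ioo 0 T, ∫⁻ x in Ioo (-L) L, ENNReal.ofReal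
      (|qt t x - q₂ t x + q₃ t x| ^ 2 * Real.exp (-(2 * s * weight L x / (t * (T - t))))) =
      ENNReal.ofReal (∫ t in Ioo 0 T, Γ t) := by
    rw [ofReal_integral_eq_lintegral_ofReal hΓi
      (Filter.Eventually.of_forall fun t => by positivity)]
    exact lintegral_congr_ae (hpt.mono fun t ht => ht.2.2)
  rw [hright, ← ENNReal.ofReal_mul (by positivity)]
  refine (lintegral_mono_ae (hpt.mono fun t ht => ht.2.1)).trans ?_
  rw [← ofReal_integral_eq_lintegral_ofReal hi (hpt.mono fun t ht => ht.1), integral_const_mul,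
    integral_sub (hΓi.const_mul 2) hDi, hD0, integral_const_mul]
  refine ENNReal.ofReal_le_ofReal (le_of_eq ?_)
  rw [hK]; ring

theorem memLp_D {q : ℝ → H 3 (-L) L} (hq : MemL2Time T q) (i : Fin 4) :
    MemLp (fun t => H.D i (q t)) 2 (volume.restrict (Ioo 0 T)) := by
  have hc : Continuous fun f : H 3 (-L) L => H.D i f :=
    (PiLp.continuous_apply 2 _ i).comp continuous_subtype_val
  exact MemLp.of_le hq (hc.comp_aestronglyMeasurable hq.1)
    (Filter.Eventually.of_forall fun t => PiLp.norm_apply_le (q t).1 i)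

end Carleman

end CarlemanKdVB


/-! ### The Carleman estimate. -/

open CarlemanKdVB in
theorem lemma3p1 (L : ℝ) (hL : 0 < L) :
    ∃ ψ : ℝ → ℝ, ContDiffOn ℝ ∞ ψ (Icc (-L) L) ∧ (∀ x ∈ Icc (-L) L, 0 < ψ x) ∧
      ∀ T : ℝ, 0 < T → ∃ s₀ C : ℝ, 0 < s₀ ∧ 0 < C ∧
        ∀ s : ℝ, s₀ ≤ s →
        ∀ (q : ℝ → CarlemanKdVB.H 3 (-L) L) (qt : ℝ → CarlemanKdVB.L2 (-L) L),
          CarlemanKdVB.MemL2Time T q →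
          CarlemanKdVB.MemH1Time T (fun t => CarlemanKdVB.H.D 0 (q t)) qt →
          (∀ᵐ t ∂(volume.restrict (Ioo 0 T)),
            CarlemanKdVB.VanishesAtEnds (CarlemanKdVB.H.D 0 (q t)) ∧
            CarlemanKdVB.VanishesAtEnds (CarlemanKdVB.H.D 1 (q t)) ∧
            CarlemanKdVB.VanishesAtEnds (CarlemanKdVB.H.D 2 (q t))) →
          ∫⁻ t in Ioo 0 T, ∫⁻ x in Ioo (-L) L, ENNReal.ofReal
              ((s ^ 5 / (t ^ 5 * (T - t) ^ 5) * |CarlemanKdVB.H.D 0 (q t) x| ^ 2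
                + s ^ 3 / (t ^ 3 * (T - t) ^ 3) * |CarlemanKdVB.H.D 1 (q t) x| ^ 2
                + s / (t * (T - t)) * |CarlemanKdVB.H.D 2 (q t) x| ^ 2)
                * Real.exp (-(2 * s * ψ x / (t * (T - t))))) ≤
            ENNReal.ofReal C * ∫⁻ t in Ioo 0 T, ∫⁻ x in Ioo (-L) L, ENNReal.ofReal
              (|qt t x - CarlemanKdVB.H.D 2 (q t) x + CarlemanKdVB.H.D 3 (q t) x| ^ 2
                * Real.exp (-(2 * s * ψ x / (t * (T - t))))) := by
  refine ⟨weight L, (contDiff_weight L).contDiffOn,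
    fun x hx => lt_of_lt_of_le (by positivity) (weight_ge hx), fun T hT => ?_⟩
  have hl := leadConst_pos hL
  have hW : 0 < weightConst L := by unfold weightConst; positivity
  refine ⟨threshold L T, 4 * weightConst L / leadConst L, hT.trans_le (le_max_left _ _),
    by positivity, fun s hs q qt hq hqt hends => ?_⟩
  obtain ⟨h0, hqt2, hweak⟩ := hqt
  -- `Q` is the absolutely continuous representative of `q` in time, with values in `L²`; it agrees
  -- with `q` at almost every time, and this together with the boundary conditions makes almost
  -- every time good.
  obtain ⟨Q, hQ, hqQ⟩ := hweak.exists_hasPrim hT (h0.integrable (by norm_num))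
    (hqt2.integrable (by norm_num))
  refine carleman_of_ae_isGoodTime hL hT hs (memLp_D hq 0) (memLp_D hq 1) (memLp_D hq 2)
    (memLp_D hq 3) hqt2 hQ ?_
  filter_upwards [hends, hqQ] with t ht hQt
  exact ⟨hQt, H.exists_isRegular hL (q t) ht.1 ht.2.1 ht.2.2⟩
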